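/- Fix an algebraic closure $\overline{\mathbb{Q}}\subseteq\mathbb{C}$ of $\mathbb{Q}$. For $\alpha\in\overline{\mathbb{Q}}$ let $f(x)=a_n x^n+\cdots+a_0\in\mathbb{Z}[x]$ be its primitive minimal polynomial, with complex roots $\alpha_1,\dots,\alpha_n$, and let $$M(\alpha)=\exp\Big(\int_0^1\log|f(e^{2\pi i t})|\,dt\Big)=|a_n|\prod_{i=1}^n\max\{1,|\alpha_i|\}$$ be the Mahler measure of $\alpha$. Then $M$ maps $\overline{\mathbb{Q}}$ to itself; put $M^0(\alpha)=\alpha$ and $M^{k}(\alpha)=M(M^{k-1}(\alpha))$ for $k\ge 1$. Call $\alpha$ preperiodic under $M$ if its orbit $\{M^k(\alpha): k\ge 0\}$ is finite, and wandering if its orbit is infinite. Let $K\subseteq\overline{\mathbb{Q}}$ be an abelian number field, that is, a finite Galois extension of $\mathbb{Q}$ with abelian Galois group, and let $K^+$ be its maximal totally real subfield. Then all elements of $K$ are preperiodic under iteration of $M$ if and only if $\mathrm{Gal}(K^+/\mathbb{Q})$ is isomorphic to $C_1$, $C_2$, $C_3$ or $C_2\times C_2$, where $C_n$ denotes the cyclic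 group of order $n$. In all other cases, $K$ contains an algebraic unit (a unit of the ring of integers of $K$) that is wandering under iteration of $M$. -/

import Mathlib

namespace MahlerIteration

open Polynomial

/-- The minimal polynomial of a complex number `z` over `ℤ`: the primitive integer polynomial
(well defined up to sign) proportional to the minimal polynomial of `z` over `ℚ`.
Only algebraic `z` matter: for transcendental `z` this is the default value `1`. -/
noncomputable def intMinpoly (z : ℂ) : ℤ[X] :=
  (IsLocalization.integerNormalization (nonZeroDivisors ℤ) (minpoly ℚ z)).primPart

/-- The Mahler measure `M(z)` of an algebraic number `z`, that is, the Mahler measure of its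
minimal polynomial over `ℤ`, viewed as a self-map so that it can be iterated. -/
noncomputable def M (z : ℂ) : ℂ :=
  (((intMinpoly z).map (Int.castRingHom ℂ)).mahlerMeasure : ℂ)

/-- The forward orbit `{z, M(z), M(M(z)), …}`. -/
def orbit (z : ℂ) : Set ℂ := Set.range fun n : ℕ => M^[n] z

/-- `z` is preperiodic under iteration of `M` if its orbit is finite. -/
def IsPreperiodic (z : ℂ) : Prop := (orbit z).Finite

/-- `z` is a wandering point for `M` if its orbit is infinite. -/
def IsWandering (z : ℂ) : Prop := (orbit z).Infinite

/-- `Cyc n` is the cyclic group of order `n` (for `n ≥ 1`), written multiplicatively. -/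
abbrev Cyc (n : ℕ) : Type := Multiplicative (ZMod n)

/-- The group `G` is isomorphic to `C₁`, `C₂`, `C₃` or `C₂ × C₂`. -/
def IsC1OrC2OrC3OrC2xC2 (G : Type*) [Group G] : Prop :=
  Nonempty (G ≃* Cyc 1) ∨ Nonempty (G ≃* Cyc 2) ∨ Nonempty (G ≃* Cyc 3) ∨
    Nonempty (G ≃* Cyc 2 × Cyc 2)

end MahlerIteration

namespace MahlerIteration

open Polynomial

/-! One application of `M` lands among the algebraic integers of `K⁺`: up to sign, `M z` is the
leading coefficient times the conjugates outside the unit disc, and complex conjugation is central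
in an abelian group. So only integers of a totally real field `F` matter. There `M` is, up to a sign
that the next `M` ignores, the product of the big conjugates (`M_M_apply`).

Preperiodicity: at most one big conjugate, or all of them big, is immediate. If all but one of `d ≥
3` are big, two steps replace `α` by `N ^ (d - 2) * r`, with `r` a conjugate and `N` the product of
all conjugates. Either `|N| = 1` and the orbit closes up, or all conjugates grow until the pattern
changes (`isPreperiodic_of_card_conjugates_eq`). This covers `d ≤ 3`. For `C₂ × C₂` the remaining
pattern, two big conjugates out of four, gives a product with a nontrivial stabilizer.

Wandering: on units, `M` acts on log vectors by `logStep`. A unit wanders if its log vector lies in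
an invariant set of vectors with trivial stabilizer and two positive entries
(`isWandering_of_logVec_mem`), and Dirichlet's unit theorem supplies units near any direction. A
group off the list maps onto a cyclic group of order at least 4, onto `C₂³` or onto `C₃²`, and one
descends to the corresponding fixed field. In the cyclic case the invariant set consists of unimodal
sign arcs, preserved by sliding window sums (`exists_isPositiveArc_windowSum`); in the other two it
comes from an explicit eigenvector. -/

/-! ### Integrality and reality of the Mahler measure. -/

theorem isIntegral_leadingCoeff_mul_root {f : ℂ[X]} (hf : ∀ i, IsIntegral ℤ (f.coeff i)) {z : ℂ}
    (hz : f.eval z = 0) : IsIntegral ℤ (f.leadingCoeff * z) := by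
  have hl : f ∈ lifts (algebraMap (integralClosure ℤ ℂ) ℂ) := by
    rw [lifts_iff_coeff_lifts]
    exact fun i => ⟨⟨f.coeff i, hf i⟩, rfl⟩
  obtain ⟨p, hp⟩ := (mem_lifts _).1 hl
  have h := isIntegral_trans (R := ℤ) _ (isIntegral_leadingCoeff_smul p z (by
    rw [aeval_def, eval₂_eq_eval_map, hp, hz]))
  rw [← hp, leadingCoeff_map_of_injective (FaithfulSMul.algebraMap_injective _ _)]
  rwa [Algebra.smul_def] at h

/-- If a product `(X - z) * g` has integral coefficients, then so does `g`. -/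
theorem isIntegral_coeff_of_X_sub_C_mul (z : ℂ) (n : ℕ) : ∀ g : ℂ[X], g.natDegree < n →
    (∀ i, IsIntegral ℤ (((X - C z) * g).coeff i)) → ∀ i, IsIntegral ℤ (g.coeff i) := by
  induction n with
  | zero => intro g hg; simp at hg
  | succ n ih =>
    intro g hg h
    have ha : IsIntegral ℤ g.leadingCoeff := by
      have := h ((X - C z) * g).natDegree
      rwa [coeff_natDegree, leadingCoeff_mul, leadingCoeff_X_sub_C, one_mul] at this
    have haz : IsIntegral ℤ (g.leadingCoeff * z) := by
      have := isIntegral_leadingCoeff_mul_root h (z := z) (by simp)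
      rwa [leadingCoeff_mul, leadingCoeff_X_sub_C, one_mul] at this
    by_cases hd : g.natDegree = 0
    · intro i
      rw [eq_C_of_natDegree_eq_zero hd] at ha ⊢
      rw [leadingCoeff_C] at ha
      rw [coeff_C]
      split_ifs
      · exact ha
      · exact isIntegral_zero
    -- Dropping the leading term of `g` changes the product only by terms with coefficients `a` and
    -- `a * z`, where `a` is the leading coefficient; both are integral.
    have hrec := ih g.eraseLead (by
      have := g.eraseLead_natDegree_lt_or_eraseLead_eq_zero
      have := g.eraseLead_natDegree_le
      lia) (by
      intro i
      have he : (X - C z) * g.eraseLead = (X - C z) * g - (C g.leadingCoeff * X ^ (g.natDegree + 1) -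
          C (g.leadingCoeff * z) * X ^ g.natDegree) := by
        rw [← self_sub_C_mul_X_pow, C_mul]; ring
      rw [he, coeff_sub, coeff_sub, coeff_C_mul_X_pow, coeff_C_mul_X_pow]
      refine (h i).sub (IsIntegral.sub ?_ ?_)
      · split_ifs
        exacts [ha, isIntegral_zero]
      · split_ifs
        exacts [haz, isIntegral_zero])
    intro i
    by_cases hi : i = g.natDegree
    · subst hi; exact ha
    · rw [← eraseLead_coeff_of_ne i hi]; exact hrec i

theorem isIntegral_coeff_of_prod_X_sub_C_mul (t : Multiset ℂ) : ∀ g : ℂ[X],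
    (∀ i, IsIntegral ℤ (((t.map (X - C ·)).prod * g).coeff i)) → ∀ i, IsIntegral ℤ (g.coeff i) := by
  induction t using Multiset.induction_on with
  | empty => intro g h; simpa using h
  | cons z t ih =>
    intro g h
    refine ih g (isIntegral_coeff_of_X_sub_C_mul z _ _ (Nat.lt_succ_self _) ?_)
    simpa [mul_assoc] using h

/-- The leading coefficient times a product of some of the roots is an algebraic integer. -/
theorem isIntegral_leadingCoeff_mul_prod_roots {f : ℂ[X]} (hf : ∀ i, IsIntegral ℤ (f.coeff i))
    (p : ℂ → Prop) [DecidablePred p] :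
    IsIntegral ℤ (f.leadingCoeff * (f.roots.filter p).prod) := by
  have hs := (IsAlgClosed.splits f).eq_prod_roots
  rw [← Multiset.filter_add_not p f.roots, Multiset.map_add, Multiset.prod_add] at hs
  -- Divide out the roots failing `p`; the constant coefficient of what remains is the desired
  -- product up to sign.
  have h := isIntegral_coeff_of_prod_X_sub_C_mul (f.roots.filter (fun x => ¬ p x))
    (C f.leadingCoeff * ((f.roots.filter p).map (X - C ·)).prod) (by
      intro i
      have := hf i
      rw [hs] at this
      convert this using 2
      ring) 0
  rw [coeff_zero_eq_eval_zero, eval_mul, eval_C, eval_multiset_prod, Multiset.map_map] at h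
  have h2 : (Multiset.map (eval 0 ∘ (X - C ·)) (f.roots.filter p)).prod =
      (-1) ^ (f.roots.filter p).card * (f.roots.filter p).prod := by
    rw [← Multiset.prod_map_neg]
    congr 1
    exact Multiset.map_congr rfl (by simp)
  rw [h2] at h
  have h3 := h.mul ((isIntegral_one (R := ℤ) (B := ℂ)).neg.pow (f.roots.filter p).card)
  have : ((-1 : ℂ) ^ (f.roots.filter p).card) * (-1) ^ (f.roots.filter p).card = 1 := by
    rw [← mul_pow]; simp
  rwa [mul_assoc, mul_right_comm _ _ ((-1 : ℂ) ^ _), this, one_mul] at h3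

theorem intMinpoly_isPrimitive (z : ℂ) : (intMinpoly z).IsPrimitive := isPrimitive_primPart _

theorem exists_intMinpoly_map_eq (z : ℂ) (hz : IsIntegral ℚ z) :
    ∃ c : ℚ, c ≠ 0 ∧ (intMinpoly z).map (algebraMap ℤ ℚ) = C c * minpoly ℚ z := by
  obtain ⟨b, hb, h⟩ := IsLocalization.integerNormalization_spec (nonZeroDivisors ℤ) (minpoly ℚ z)
  set N := IsLocalization.integerNormalization (nonZeroDivisors ℤ) (minpoly ℚ z) with hN
  have hN0 : N ≠ 0 := by
    rw [hN, Ne, IsFractionRing.integerNormalization_eq_zero_iff]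
    exact minpoly.ne_zero hz
  have hc : (N.content : ℚ) ≠ 0 := by
    exact_mod_cast fun h0 => hN0 (content_eq_zero_iff.1 h0)
  have hb0 : (b : ℚ) ≠ 0 := by exact_mod_cast nonZeroDivisors.ne_zero hb
  refine ⟨(N.content : ℚ)⁻¹ * b, mul_ne_zero (inv_ne_zero hc) hb0, ?_⟩
  have h1 : N.map (algebraMap ℤ ℚ) = C (N.content : ℚ) * (intMinpoly z).map (algebraMap ℤ ℚ) := by
    conv_lhs => rw [N.eq_C_content_mul_primPart]
    simp [intMinpoly, hN]
  rw [h1] at h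
  have h2 : b • minpoly ℚ z = C (b : ℚ) * minpoly ℚ z := by
    rw [← smul_eq_C_mul, Int.cast_smul_eq_zsmul]
  rw [h2] at h
  rw [C_mul, mul_assoc, ← h, ← mul_assoc, ← C_mul, inv_mul_cancel₀ hc, C_1, one_mul]

theorem roots_intMinpoly_map (z : ℂ) (hz : IsIntegral ℚ z) :
    ((intMinpoly z).map (Int.castRingHom ℂ)).roots =
      ((minpoly ℚ z).map (algebraMap ℚ ℂ)).roots := by
  obtain ⟨c, hc, h⟩ := exists_intMinpoly_map_eq z hz
  have h1 : (intMinpoly z).map (Int.castRingHom ℂ) =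
      C (c : ℂ) * (minpoly ℚ z).map (algebraMap ℚ ℂ) := by
    have := congrArg (Polynomial.map (algebraMap ℚ ℂ)) h
    rw [Polynomial.map_map, Polynomial.map_mul, map_C] at this
    rw [← (Subsingleton.elim _ _ : (algebraMap ℚ ℂ).comp (algebraMap ℤ ℚ) = Int.castRingHom ℂ),
      this]
    rfl
  rw [h1, roots_C_mul _ (by exact_mod_cast hc)]

/-- By Gauss's lemma the primitive polynomial divides the monic `minpoly ℤ z` over `ℤ`. -/
theorem isUnit_leadingCoeff_intMinpoly (z : ℂ) (hz : IsIntegral ℤ z) :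
    IsUnit (intMinpoly z).leadingCoeff := by
  obtain ⟨c, hc, h⟩ := exists_intMinpoly_map_eq z hz.tower_top
  have hd : intMinpoly z ∣ minpoly ℤ z := by
    rw [IsPrimitive.Int.dvd_iff_map_cast_dvd_map_cast _ _ (intMinpoly_isPrimitive z)]
    change (intMinpoly z).map (algebraMap ℤ ℚ) ∣ (minpoly ℤ z).map (algebraMap ℤ ℚ)
    rw [h, ← minpoly.isIntegrallyClosed_eq_field_fractions' ℚ hz]
    refine ⟨C c⁻¹, ?_⟩
    rw [mul_comm, ← mul_assoc, ← C_mul, inv_mul_cancel₀ hc, C_1, one_mul]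
  obtain ⟨q, hq⟩ := hd
  have := congrArg leadingCoeff hq
  rw [leadingCoeff_mul, (minpoly.monic hz).leadingCoeff] at this
  exact IsUnit.of_mul_eq_one _ this.symm

theorem prod_max_one_norm (s : Multiset ℂ) :
    (s.map (fun a => max 1 ‖a‖)).prod = ‖(s.filter (fun a => 1 < ‖a‖)).prod‖ := by
  induction s using Multiset.induction_on with
  | empty => simp
  | cons a s ih =>
    rw [Multiset.map_cons, Multiset.prod_cons, ih]
    by_cases h : 1 < ‖a‖
    · rw [Multiset.filter_cons_of_pos (p := fun a : ℂ => 1 < ‖a‖) _ h, Multiset.prod_cons, norm_mul, max_eq_right h.le]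
    · rw [Multiset.filter_cons_of_neg (p := fun a : ℂ => 1 < ‖a‖) _ h, max_eq_left (not_lt.1 h), one_mul]

theorem M_eq_norm (z : ℂ) (hz : IsIntegral ℚ z) :
    M z = (‖((intMinpoly z).leadingCoeff : ℂ) *
      (((minpoly ℚ z).map (algebraMap ℚ ℂ)).roots.filter (fun a => 1 < ‖a‖)).prod‖ : ℝ) := by
  rw [M, mahlerMeasure_eq_leadingCoeff_mul_prod_roots, prod_max_one_norm,
    roots_intMinpoly_map z hz, norm_mul, leadingCoeff_map_of_injective (RingHom.injective_int _)]
  rfl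

theorem M_eq_prod_of_isIntegral (z : ℂ) (hz : IsIntegral ℤ z) :
    M z = ((((minpoly ℚ z).map (algebraMap ℚ ℂ)).roots.map (fun a => max 1 ‖a‖)).prod : ℝ) := by
  rw [M_eq_norm z hz.tower_top, prod_max_one_norm, norm_mul]
  rcases Int.isUnit_iff.1 (isUnit_leadingCoeff_intMinpoly z hz) with h | h <;> simp [h]

/-- The Mahler measure is, up to sign, the leading coefficient times the product of the conjugates
outside the unit disc. -/
theorem M_eq_or_eq_neg (z : ℂ) (hz : IsIntegral ℚ z) :
    let w := ((intMinpoly z).leadingCoeff : ℂ) *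
      (((minpoly ℚ z).map (algebraMap ℚ ℂ)).roots.filter (fun a => 1 < ‖a‖)).prod
    M z = w ∨ M z = -w := by
  intro w
  set R := ((minpoly ℚ z).map (algebraMap ℚ ℂ)).roots with hR
  -- The roots, and those outside the disc, are stable under conjugation, so `w` is real and its
  -- norm is `±w`.
  have hconj : R.map (starRingEnd ℂ) = R := by
    have h1 : ((minpoly ℚ z).map (algebraMap ℚ ℂ)).map (starRingEnd ℂ) =
        (minpoly ℚ z).map (algebraMap ℚ ℂ) := by
      rw [Polynomial.map_map]
      congr 1
      exact Subsingleton.elim _ _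
    have h2 := (IsAlgClosed.splits ((minpoly ℚ z).map (algebraMap ℚ ℂ))).roots_map (starRingEnd ℂ)
    rw [h1] at h2
    exact h2.symm
  have hP : starRingEnd ℂ w = w := by
    simp only [w, map_mul, map_multiset_prod]
    congr 2
    · simp
    · conv_rhs => rw [← hR, ← hconj, Multiset.filter_map]
      simp
      rfl
  obtain ⟨r, hr⟩ := Complex.conj_eq_iff_real.1 hP
  rw [M_eq_norm z hz]
  change ((‖w‖ : ℝ) : ℂ) = w ∨ ((‖w‖ : ℝ) : ℂ) = -w
  rw [hr, Complex.norm_real, Real.norm_eq_abs]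
  rcases abs_choice r with h | h <;> simp [h]

theorem isIntegral_M (z : ℂ) (hz : IsIntegral ℚ z) : IsIntegral ℤ (M z) := by
  have h := isIntegral_leadingCoeff_mul_prod_roots
    (f := (intMinpoly z).map (Int.castRingHom ℂ)) (fun i => by
      rw [coeff_map]; exact isIntegral_algebraMap (R := ℤ) (A := ℂ)) (fun a => 1 < ‖a‖)
  rw [roots_intMinpoly_map z hz, leadingCoeff_map_of_injective (RingHom.injective_int _)] at h
  rcases M_eq_or_eq_neg z hz with h' | h' <;> rw [h']
  · exact h
  · exact h.neg

/-! ### Orbits and preperiodicity. -/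

theorem orbit_eq_insert (z : ℂ) : orbit z = insert z (orbit (M z)) := by
  ext w
  simp only [orbit, Set.mem_range, Set.mem_insert_iff]
  constructor
  · rintro ⟨n, rfl⟩
    rcases n with _ | n
    · left; rfl
    · right; exact ⟨n, rfl⟩
  · rintro (rfl | ⟨n, rfl⟩)
    · exact ⟨0, rfl⟩
    · exact ⟨n + 1, rfl⟩

theorem isPreperiodic_M_iff (z : ℂ) : IsPreperiodic (M z) ↔ IsPreperiodic z := by
  rw [IsPreperiodic, IsPreperiodic, orbit_eq_insert z, Set.finite_insert]

theorem isPreperiodic_of_M_eq {z w : ℂ} (h : M z = M w) (hw : IsPreperiodic w) :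
    IsPreperiodic z := by
  rwa [← isPreperiodic_M_iff, h, isPreperiodic_M_iff]

theorem isPreperiodic_of_M_M_eq {z : ℂ} (h : M (M z) = z) : IsPreperiodic z := by
  refine Set.Finite.subset (Set.toFinite {z, M z}) ?_
  rintro _ ⟨n, rfl⟩
  have key : ∀ n, M^[n] z = z ∨ M^[n] z = M z := by
    intro n
    induction n with
    | zero => left; rfl
    | succ n ih =>
      rw [Function.iterate_succ_apply']
      rcases ih with ih | ih <;> rw [ih]
      · right; rfl
      · left; exact h
  simpa using key n

theorem isIntegral_int_apply_iff {K : Type*} [Field K] (φ : K →+* ℂ) (α : K) :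
    IsIntegral ℤ (φ α) ↔ IsIntegral ℤ α :=
  isIntegral_algHom_iff φ.toIntAlgHom φ.injective

/-! ### The Mahler measure through Galois conjugates. -/

section Galois

variable {K : Type*} [Field K] [NumberField K]

open scoped Classical in
/-- The finite set of Galois conjugates of an element of a number field `K`. -/
noncomputable def conjugates (α : K) : Finset K :=
  Finset.univ.image fun σ : Gal(K/ℚ) => σ α

theorem mem_conjugates {α β : K} : β ∈ conjugates α ↔ ∃ σ : Gal(K/ℚ), σ α = β := by
  simp [conjugates]

theorem apply_mem_conjugates (α : K) (σ : Gal(K/ℚ)) : σ α ∈ conjugates α :=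
  mem_conjugates.2 ⟨σ, rfl⟩

theorem conjugates_apply (σ : Gal(K/ℚ)) (α : K) : conjugates (σ α) = conjugates α := by
  ext β
  simp only [mem_conjugates]
  constructor
  · rintro ⟨τ, rfl⟩; exact ⟨τ * σ, rfl⟩
  · rintro ⟨τ, rfl⟩; exact ⟨τ * σ⁻¹, by rw [AlgEquiv.mul_apply, ← AlgEquiv.mul_apply σ⁻¹]; simp⟩

theorem conjugates_eq_of_mem {α β : K} (h : β ∈ conjugates α) : conjugates β = conjugates α := by
  obtain ⟨σ, rfl⟩ := mem_conjugates.1 h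
  exact conjugates_apply σ α

open scoped Classical in
/-- A map commuting with the Galois action maps conjugates to conjugates. -/
theorem conjugates_map (f : K → K) (hf : ∀ (σ : Gal(K/ℚ)) x, σ (f x) = f (σ x)) (α : K) :
    conjugates (f α) = (conjugates α).image f := by
  ext β
  simp [conjugates, hf]

theorem isIntegral_of_mem_conjugates {α β : K} (hα : IsIntegral ℤ α) (h : β ∈ conjugates α) :
    IsIntegral ℤ β := by
  obtain ⟨σ, rfl⟩ := mem_conjugates.1 h
  exact hα.map (σ.toAlgHom.restrictScalars ℤ)

theorem prod_conjugates_apply (α : K) (σ : Gal(K/ℚ)) :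
    σ (∏ r ∈ conjugates α, r) = ∏ r ∈ conjugates α, r := by
  rw [map_prod]
  refine Finset.prod_bij (fun r _ => σ r) ?_ ?_ ?_ ?_
  · intro r hr
    rw [← conjugates_eq_of_mem hr]; exact apply_mem_conjugates r σ
  · intro a _ b _ h; exact σ.injective h
  · intro r hr
    refine ⟨σ⁻¹ r, ?_, ?_⟩
    · rw [← conjugates_eq_of_mem hr]; exact apply_mem_conjugates r σ⁻¹
    · rw [← AlgEquiv.mul_apply]; simp
  · intro r _; rfl

variable (φ : K →+* ℂ)

theorem isIntegral_rat_apply (α : K) : IsIntegral ℚ (φ α) :=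
  (Algebra.IsIntegral.isIntegral (R := ℚ) α).map φ.toRatAlgHom

/-- The conjugates of `α` outside the unit disc. -/
noncomputable def bigConjugates (α : K) : Finset K := (conjugates α).filter fun r => 1 < ‖φ r‖

theorem mem_bigConjugates {α r : K} :
    r ∈ bigConjugates φ α ↔ r ∈ conjugates α ∧ 1 < ‖φ r‖ := by
  simp [bigConjugates]

theorem bigConjugates_subset (α : K) : bigConjugates φ α ⊆ conjugates α := Finset.filter_subset _ _

theorem isIntegral_prod_bigConjugates {α : K} (hα : IsIntegral ℤ α) :
    IsIntegral ℤ (∏ r ∈ bigConjugates φ α, r) :=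
  IsIntegral.prod _ fun _ hr => isIntegral_of_mem_conjugates hα (bigConjugates_subset φ α hr)

variable [IsGalois ℚ K]

/-- Separability makes the root multiset duplicate-free, so a finset of conjugates loses no
multiplicity. -/
theorem roots_minpoly_map_eq (α : K) :
    ((minpoly ℚ (φ α)).map (algebraMap ℚ ℂ)).roots = (conjugates α).val.map φ := by
  have h1 : minpoly ℚ (φ α) = minpoly ℚ α := minpoly.algHom_eq φ.toRatAlgHom φ.injective α
  have h2 : (minpoly ℚ α).map (algebraMap ℚ ℂ) = ((minpoly ℚ α).map (algebraMap ℚ K)).map φ := by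
    rw [Polynomial.map_map]; congr 1; exact Subsingleton.elim _ _
  have hs : ((minpoly ℚ α).map (algebraMap ℚ K)).Splits := Normal.splits inferInstance α
  rw [h1, h2, hs.roots_map φ]
  congr 1
  have hi : IsIntegral ℚ α := Algebra.IsIntegral.isIntegral α
  refine (Multiset.Nodup.ext (nodup_roots (minpoly.irreducible hi).separable.map)
    (conjugates α).nodup).2 fun β => ?_
  rw [mem_roots (Polynomial.map_ne_zero (minpoly.ne_zero hi)), IsRoot.def, eval_map_algebraMap,
    Finset.mem_val, mem_conjugates]
  constructor
  · intro h
    have : minpoly ℚ β = minpoly ℚ α := (minpoly.eq_of_irreducible_of_monic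
      (minpoly.irreducible hi) h (minpoly.monic hi)).symm
    exact (Normal.minpoly_eq_iff_mem_orbit (F := ℚ) K).1 this
  · rintro ⟨σ, rfl⟩
    rw [← minpoly.algEquiv_eq σ α]; exact minpoly.aeval _ _

/-- The Mahler measure of an algebraic integer of a Galois number field in terms of its
conjugates. -/
theorem M_apply_eq (α : K) (hα : IsIntegral ℤ α) :
    M (φ α) = (∏ r ∈ conjugates α, max 1 ‖φ r‖ : ℝ) := by
  rw [M_eq_prod_of_isIntegral _ ((isIntegral_int_apply_iff φ α).2 hα), roots_minpoly_map_eq,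
    Multiset.map_map]
  rfl

theorem M_apply_eq_norm (α : K) (hα : IsIntegral ℤ α) :
    M (φ α) = (‖φ (∏ r ∈ bigConjugates φ α, r)‖ : ℝ) := by
  rw [M_apply_eq φ α hα, map_prod, norm_prod, bigConjugates, Finset.prod_filter]
  congr 1
  refine Finset.prod_congr rfl fun r _ => ?_
  split_ifs with h
  · exact max_eq_right h.le
  · exact max_eq_left (not_lt.1 h)

theorem M_apply_conj (σ : Gal(K/ℚ)) (α : K) (hα : IsIntegral ℤ α) : M (φ (σ α)) = M (φ α) := by
  rw [M_apply_eq φ _ (isIntegral_of_mem_conjugates hα (apply_mem_conjugates α σ)), M_apply_eq φ _ hα,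
    conjugates_apply]

theorem M_apply_neg (α : K) (hα : IsIntegral ℤ α) : M (φ (-α)) = M (φ α) := by
  classical
  rw [M_apply_eq φ _ hα.neg, M_apply_eq φ _ hα, conjugates_map (fun x => -x) (by simp),
    Finset.prod_image (fun a _ b _ h => neg_injective h)]
  simp

/-- The Mahler measure of an element of an abelian field is an algebraic integer of its maximal
real subfield. -/
theorem exists_mem_maximalRealSubfield_apply_eq_M [IsMulCommutative Gal(K/ℚ)] (α : K) :
    ∃ β : NumberField.maximalRealSubfield K, φ β = M (φ α) ∧ IsIntegral ℤ β := by
  classical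
  have hz := isIntegral_rat_apply φ α
  obtain ⟨β, hβ⟩ : ∃ β : K, φ β = M (φ α) := by
    have hw : ∃ w : K, φ w = ((intMinpoly (φ α)).leadingCoeff : ℂ) *
        (((minpoly ℚ (φ α)).map (algebraMap ℚ ℂ)).roots.filter (fun a => 1 < ‖a‖)).prod := by
      rw [roots_minpoly_map_eq, Multiset.filter_map]
      refine ⟨(intMinpoly (φ α)).leadingCoeff *
        ((conjugates α).val.filter ((fun a => 1 < ‖a‖) ∘ φ)).prod, ?_⟩
      rw [map_mul, map_intCast, map_multiset_prod]
    obtain ⟨w, hw⟩ := hw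
    rcases M_eq_or_eq_neg (φ α) hz with h | h
    · exact ⟨w, by rw [hw, h]⟩
    · exact ⟨-w, by rw [map_neg, hw, h]⟩
  have hint : IsIntegral ℤ β := by
    rw [← isIntegral_int_apply_iff φ, hβ]; exact isIntegral_M _ hz
  have hreal : starRingEnd ℂ (φ β) = φ β := by
    rw [hβ, M, Complex.conj_ofReal]
  have hmem : β ∈ NumberField.maximalRealSubfield K := by
    rw [NumberField.mem_maximalRealSubfield_iff]
    -- Every embedding is `φ ∘ σ`. Complex conjugation therefore comes from some `c` in the Galois
    -- group; as `c` commutes with every `σ`, being real under `φ` implies being real under all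
    -- embeddings.
    have key : ∀ ψ : K →+* ℂ, ∃ σ : Gal(K/ℚ), ∀ x, ψ x = φ (σ x) := by
      intro ψ
      obtain ⟨σ, hσ⟩ := NumberField.ComplexEmbedding.exists_comp_symm_eq_of_comp_eq (k := ℚ) φ ψ
        (Subsingleton.elim _ _)
      exact ⟨σ.symm, fun x => by rw [← hσ]; simp⟩
    obtain ⟨c, hc⟩ := key ((starRingEnd ℂ).comp φ)
    intro ψ
    obtain ⟨σ, hσ⟩ := key ψ
    have hcβ : c β = β := φ.injective (by rw [← hc]; exact hreal)
    have := hc (σ β)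
    rw [hσ]
    change starRingEnd ℂ (φ (σ β)) = _
    rw [RingHom.comp_apply] at this
    rw [this, ← AlgEquiv.mul_apply, mul_comm' c σ, AlgEquiv.mul_apply, hcβ]
  exact ⟨⟨β, hmem⟩, hβ, (isIntegral_algHom_iff
    ((NumberField.maximalRealSubfield K).subtype.toIntAlgHom) Subtype.val_injective).1 hint⟩

end Galois

/-! ### Preperiodic integers of totally real fields. -/

theorem exists_ofReal_eq_apply {F : Type*} [Field F] [NumberField.IsTotallyReal F]
    (φ : F →+* ℂ) (x : F) : ∃ r : ℝ, φ x = r := by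
  have h := NumberField.ComplexEmbedding.isReal_iff.1
    (NumberField.IsTotallyReal.complexEmbedding_isReal φ)
  have := RingHom.congr_fun h x
  exact Complex.conj_eq_iff_real.1 this

theorem norm_apply_eq_or {F : Type*} [Field F] [NumberField.IsTotallyReal F] (φ : F →+* ℂ)
    (x : F) : ((‖φ x‖ : ℝ) : ℂ) = φ x ∨ ((‖φ x‖ : ℝ) : ℂ) = φ (-x) := by
  obtain ⟨r, hr⟩ := exists_ofReal_eq_apply φ x
  rw [map_neg, hr, Complex.norm_real, Real.norm_eq_abs]
  rcases abs_choice r with h | h <;> simp [h]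

theorem exists_int_eq_of_forall_apply_eq {F : Type*} [Field F] [NumberField F] [IsGalois ℚ F]
    (x : F) (hx : IsIntegral ℤ x)
    (h : ∀ σ : Gal(F/ℚ), σ x = x) : ∃ n : ℤ, (n : F) = x := by
  obtain ⟨q, hq⟩ := (IsGalois.mem_range_algebraMap_iff_fixed x).2 h
  rw [← hq] at hx
  have hq' : IsIntegral ℤ q := (isIntegral_algebraMap_iff (algebraMap ℚ F).injective).1 hx
  obtain ⟨n, rfl⟩ := IsIntegrallyClosed.isIntegral_iff.1 hq'
  exact ⟨n, by rw [← hq]; simp⟩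

theorem ne_zero_of_two_le_card_conjugates {F : Type*} [Field F] [NumberField F] {α : F}
    (h : 2 ≤ (conjugates α).card) : α ≠ 0 := by
  rintro rfl
  have : conjugates (0 : F) = {0} := by ext x; simp [mem_conjugates, eq_comm]
  simp [this] at h

/-- If all but one of the `d` conjugates of `α` lie outside the unit disc, then their product is
`N / t` with `N` the product of all conjugates and `t` the exceptional one. -/
theorem prod_bigConjugates_of_card_succ {F : Type*} [Field F] [NumberField F]
    (φ : F →+* ℂ) {α : F} (hα : α ≠ 0)
    (h : (bigConjugates φ α).card + 1 = (conjugates α).card) :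
    ∃ t ∈ conjugates α, ∏ r ∈ bigConjugates φ α, r = (∏ r ∈ conjugates α, r) / t := by
  classical
  have hc : (conjugates α \ bigConjugates φ α).card = 1 := by
    rw [Finset.card_sdiff_of_subset (bigConjugates_subset φ α)]; lia
  obtain ⟨t, ht⟩ := Finset.card_eq_one.1 hc
  have htm : t ∈ conjugates α := by
    have : t ∈ conjugates α \ bigConjugates φ α := by simp [ht]
    exact (Finset.mem_sdiff.1 this).1
  have ht0 : t ≠ 0 := by
    obtain ⟨σ, rfl⟩ := mem_conjugates.1 htm
    simpa using hα
  refine ⟨t, htm, ?_⟩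
  rw [eq_div_iff ht0, ← Finset.prod_sdiff (bigConjugates_subset φ α), ht, Finset.prod_singleton,
    mul_comm]

section TotallyReal

variable {F : Type*} [Field F] [NumberField F] [NumberField.IsTotallyReal F] (φ : F →+* ℂ)

variable [IsGalois ℚ F]

theorem M_norm_apply (x : F) (hx : IsIntegral ℤ x) : M ((‖φ x‖ : ℝ) : ℂ) = M (φ x) := by
  rcases norm_apply_eq_or φ x with h | h <;> rw [h]
  exact M_apply_neg φ x hx

theorem M_M_apply (α : F) (hα : IsIntegral ℤ α) :
    M (M (φ α)) = M (φ (∏ r ∈ bigConjugates φ α, r)) := by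
  rw [M_apply_eq_norm φ α hα, M_norm_apply φ _ (isIntegral_prod_bigConjugates φ hα)]

theorem isPreperiodic_of_prod_bigConjugates (α : F) (hα : IsIntegral ℤ α)
    (h : IsPreperiodic (φ (∏ r ∈ bigConjugates φ α, r))) : IsPreperiodic (φ α) :=
  (isPreperiodic_M_iff _).1 (isPreperiodic_of_M_eq (M_M_apply φ α hα) h)

/-- With no big conjugate the measure is 1; with a single one, `M α` is up to sign a conjugate of
`α`, so `M (M α) = M α`. -/
theorem isPreperiodic_of_card_bigConjugates_le_one (α : F) (hα : IsIntegral ℤ α)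
    (h : (bigConjugates φ α).card ≤ 1) : IsPreperiodic (φ α) := by
  rw [← isPreperiodic_M_iff]
  have h2 : M (M (φ α)) = M (φ α) := by
    rw [M_M_apply φ α hα]
    rcases Nat.le_one_iff_eq_zero_or_eq_one.1 h with h0 | h1
    · have h0' := Finset.card_eq_zero.1 h0
      rw [M_apply_eq_norm φ α hα, h0', Finset.prod_empty, M_apply_eq φ 1 isIntegral_one]
      have : conjugates (1 : F) = {1} := by
        ext x; simp [mem_conjugates, eq_comm]
      simp [this]
    · obtain ⟨r, hr⟩ := Finset.card_eq_one.1 h1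
      rw [hr, Finset.prod_singleton]
      have : r ∈ conjugates α := bigConjugates_subset φ α (by simp [hr])
      obtain ⟨σ, rfl⟩ := mem_conjugates.1 this
      exact M_apply_conj φ σ α hα
  exact isPreperiodic_of_M_M_eq (by rw [h2, h2])

theorem isPreperiodic_of_forall_apply_eq (α : F) (hα : IsIntegral ℤ α)
    (h : ∀ σ : Gal(F/ℚ), σ α = α) : IsPreperiodic (φ α) := by
  refine isPreperiodic_of_card_bigConjugates_le_one φ α hα ?_
  refine (Finset.card_le_card (bigConjugates_subset φ α)).trans (Finset.card_le_one.2 ?_)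
  intro a ha b hb
  obtain ⟨σ, rfl⟩ := mem_conjugates.1 ha
  obtain ⟨τ, rfl⟩ := mem_conjugates.1 hb
  rw [h, h]

theorem isPreperiodic_of_bigConjugates_eq (α : F) (hα : IsIntegral ℤ α)
    (h : bigConjugates φ α = conjugates α) : IsPreperiodic (φ α) := by
  refine isPreperiodic_of_prod_bigConjugates φ α hα ?_
  refine isPreperiodic_of_forall_apply_eq φ _ (isIntegral_prod_bigConjugates φ hα) ?_
  rw [h]
  exact prod_conjugates_apply α

/-- Reduction of preperiodicity for elements with `d ≥ 3` conjugates to the elements for which the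
number of conjugates outside the unit disc is not `d - 1`. -/
theorem isPreperiodic_of_card_conjugates_eq {d : ℕ} (hd : 3 ≤ d)
    (H : ∀ β : F, IsIntegral ℤ β → (conjugates β).card = d → (bigConjugates φ β).card + 1 ≠ d →
      IsPreperiodic (φ β)) (α : F) (hα : IsIntegral ℤ α) (hc : (conjugates α).card = d) :
    IsPreperiodic (φ α) := by
  classical
  -- The exponent `j` measures how far the conjugates are from all lying outside the disc; `j = 0`
  -- means that they do.
  have key : ∀ j : ℕ, ∀ α : F, IsIntegral ℤ α → (conjugates α).card = d →
      (∀ r ∈ conjugates α, 1 < 2 ^ j * ‖φ r‖) → IsPreperiodic (φ α) := by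
    intro j
    induction j with
    | zero =>
      intro α hα hc hj
      refine isPreperiodic_of_bigConjugates_eq φ α hα ?_
      ext r
      rw [mem_bigConjugates]
      exact ⟨fun h => h.1, fun h => ⟨h, by simpa using hj r h⟩⟩
    | succ j ih =>
      intro α hα hc hj
      by_cases hb : (bigConjugates φ α).card + 1 = d
      swap
      · exact H α hα hc hb
      have hα0 : α ≠ 0 := ne_zero_of_two_le_card_conjugates (by lia)
      obtain ⟨t, ht, hγ⟩ := prod_bigConjugates_of_card_succ φ hα0 (hb.trans hc.symm)
      set N := ∏ r ∈ conjugates α, r with hN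
      have hNσ : ∀ σ : Gal(F/ℚ), σ N = N := prod_conjugates_apply α
      have hNint : IsIntegral ℤ N :=
        IsIntegral.prod _ fun _ hr => isIntegral_of_mem_conjugates hα hr
      have hconj0 : ∀ r ∈ conjugates α, r ≠ 0 := by
        intro r hr
        obtain ⟨σ, rfl⟩ := mem_conjugates.1 hr
        simpa using hα0
      have hN0 : N ≠ 0 := Finset.prod_ne_zero_iff.2 hconj0
      set γ := ∏ r ∈ bigConjugates φ α, r with hγdef
      have hγint : IsIntegral ℤ γ := isIntegral_prod_bigConjugates φ hα
      have hγc : conjugates γ = (conjugates α).image (fun x => N / x) := by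
        rw [hγ, conjugates_map (fun x => N / x) (fun σ x => by rw [map_div₀, hNσ]),
          conjugates_eq_of_mem ht]
      have hinj : Function.Injective (fun x : F => N / x) := by
        intro a b hab
        simpa [div_eq_mul_inv, hN0] using hab
      have hγcard : (conjugates γ).card = d := by
        rw [hγc, Finset.card_image_of_injective _ hinj, hc]
      refine isPreperiodic_of_prod_bigConjugates φ α hα ?_
      rw [← hγdef]
      by_cases hbγ : (bigConjugates φ γ).card + 1 = d
      swap
      · exact H γ hγint hγcard hbγ
      obtain ⟨t', ht', hδ⟩ := prod_bigConjugates_of_card_succ φ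
        (ne_zero_of_two_le_card_conjugates (by lia)) (hbγ.trans hγcard.symm)
      rw [hγc] at ht'
      obtain ⟨r, hr, rfl⟩ := Finset.mem_image.1 ht'
      have hr0 := hconj0 r hr
      -- The conjugates of `γ` are the `N / x`, with product `N ^ (d - 1)`; omitting the exceptional
      -- `N / r` leaves this.
      have hδ' : ∏ x ∈ bigConjugates φ γ, x = N ^ (d - 2) * r := by
        rw [hδ, hγc, Finset.prod_image hinj.injOn, Finset.prod_div_distrib, Finset.prod_const, hc,
          ← hN]
        obtain ⟨e, rfl⟩ : ∃ e, d = e + 2 := ⟨d - 2, by lia⟩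
        rw [Nat.add_sub_cancel]
        field_simp
        ring
      obtain ⟨n, hn⟩ := exists_int_eq_of_forall_apply_eq N hNint hNσ
      have hn0 : n ≠ 0 := by rintro rfl; exact hN0 (by rw [← hn]; simp)
      by_cases hn1 : |n| = 1
      · have hM : M (φ (∏ x ∈ bigConjugates φ γ, x)) = M (φ α) := by
          have hrM : M (φ r) = M (φ α) := by
            obtain ⟨σ, rfl⟩ := mem_conjugates.1 hr
            exact M_apply_conj φ σ α hα
          have hNpow : N ^ (d - 2) = 1 ∨ N ^ (d - 2) = -1 := by
            rcases (abs_eq (by norm_num)).1 hn1 with h | h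
            · left; rw [← hn, h]; simp
            · rw [← hn, h]; simpa using neg_one_pow_eq_or F (d - 2)
          rw [hδ']
          rcases hNpow with h | h <;> rw [h]
          · rw [one_mul, hrM]
          · rw [neg_one_mul, M_apply_neg φ r (isIntegral_of_mem_conjugates hα hr), hrM]
        have hz : M (M (M (φ α))) = M (φ α) := by
          rw [M_M_apply φ α hα, ← hγdef, M_M_apply φ γ hγint, hM]
        have h1 : IsPreperiodic (φ α) := (isPreperiodic_M_iff _).1 (isPreperiodic_of_M_M_eq hz)
        refine isPreperiodic_of_M_eq (w := M (φ α)) ?_ ((isPreperiodic_M_iff _).2 h1)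
        rw [M_M_apply φ α hα]
      -- Since `d - 2 ≥ 1`, every conjugate is now scaled by at least 2, which lowers `j` by one.
      · have hn2 : 2 ≤ |n| := by
          have := abs_pos.2 hn0
          lia
        refine isPreperiodic_of_prod_bigConjugates φ γ hγint ?_
        have hpint : IsIntegral ℤ (N ^ (d - 2)) := hNint.pow _
        have hcc : ∀ x : F, conjugates (N ^ (d - 2) * x) =
            (conjugates x).image (fun x => N ^ (d - 2) * x) := fun x =>
          conjugates_map (fun x => N ^ (d - 2) * x) (fun σ x => by rw [map_mul, map_pow, hNσ]) x
        rw [hδ']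
        refine ih _ (hpint.mul (isIntegral_of_mem_conjugates hα hr)) ?_ ?_
        · rw [hcc, conjugates_eq_of_mem hr,
            Finset.card_image_of_injective _ (mul_right_injective₀ (pow_ne_zero _ hN0)), hc]
        · intro x hx
          rw [hcc, conjugates_eq_of_mem hr] at hx
          obtain ⟨s, hs, rfl⟩ := Finset.mem_image.1 hx
          have h1 := hj s hs
          have h2 : (2 : ℝ) ≤ ‖φ (N ^ (d - 2))‖ := by
            rw [← hn, map_pow, map_intCast, norm_pow, Complex.norm_intCast]
            have h3 : (2 : ℝ) ≤ |(n : ℝ)| := by exact_mod_cast hn2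
            calc (2 : ℝ) ≤ |(n : ℝ)| := h3
              _ ≤ |(n : ℝ)| ^ (d - 2) := le_self_pow₀ (by linarith) (by lia)
          rw [map_mul, norm_mul]
          calc (1 : ℝ) < 2 ^ (j + 1) * ‖φ s‖ := h1
            _ = 2 ^ j * (2 * ‖φ s‖) := by ring
            _ ≤ 2 ^ j * (‖φ (N ^ (d - 2))‖ * ‖φ s‖) := by gcongr
  have hα0 : α ≠ 0 := ne_zero_of_two_le_card_conjugates (by lia)
  have hex : ∀ r ∈ conjugates α, ∃ j : ℕ, 1 < 2 ^ j * ‖φ r‖ := by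
    intro r hr
    obtain ⟨σ, rfl⟩ := mem_conjugates.1 hr
    have hpos : 0 < ‖φ (σ α)‖ := by simpa using hα0
    obtain ⟨j, hj⟩ := pow_unbounded_of_one_lt (‖φ (σ α)‖⁻¹) (one_lt_two (α := ℝ))
    exact ⟨j, by rwa [inv_lt_iff_one_lt_mul₀ hpos] at hj⟩
  choose! j hj using hex
  refine key ((conjugates α).sup j) α hα hc fun r hr => (hj r hr).trans_le ?_
  gcongr
  · norm_num
  · exact Finset.le_sup hr

/-- The only count of big conjugates other than 0, 1 or all is two out of three, the case `d - 1` of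
the reduction. -/
theorem isPreperiodic_of_card_conjugates_le_three (α : F) (hα : IsIntegral ℤ α)
    (hc : (conjugates α).card ≤ 3) : IsPreperiodic (φ α) := by
  have base : ∀ β : F, IsIntegral ℤ β → (conjugates β).card ≤ 3 →
      ((conjugates β).card = 3 → (bigConjugates φ β).card + 1 ≠ 3) → IsPreperiodic (φ β) := by
    intro β hβ h3 hne
    have hle := Finset.card_le_card (bigConjugates_subset φ β)
    by_cases h1 : (bigConjugates φ β).card ≤ 1
    · exact isPreperiodic_of_card_bigConjugates_le_one φ β hβ h1
    · exact isPreperiodic_of_bigConjugates_eq φ β hβ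
        (Finset.eq_of_subset_of_card_le (bigConjugates_subset φ β) (by lia))
  by_cases h3 : (conjugates α).card = 3
  · exact isPreperiodic_of_card_conjugates_eq φ le_rfl
      (fun β hβ hβc hb => base β hβ hβc.le fun _ => hb) α hα h3
  · exact base α hα hc fun h => absurd h h3

/-- In a totally real field with Galois group of order at most `3`, or of order `4` and exponent
`2`, every algebraic integer is preperiodic. -/
theorem isPreperiodic_of_isIntegral
    (hG : Nat.card Gal(F/ℚ) ≤ 3 ∨ (Nat.card Gal(F/ℚ) = 4 ∧ ∀ σ : Gal(F/ℚ), σ * σ = 1))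
    (α : F) (hα : IsIntegral ℤ α) : IsPreperiodic (φ α) := by
  classical
  have hcard : ∀ β : F, (conjugates β).card ≤ Nat.card Gal(F/ℚ) := by
    intro β
    rw [Nat.card_eq_fintype_card]
    exact Finset.card_image_le
  rcases hG with hG | ⟨hG, hG2⟩
  · exact isPreperiodic_of_card_conjugates_le_three φ α hα ((hcard α).trans hG)
  by_cases h4 : (conjugates α).card ≤ 3
  · exact isPreperiodic_of_card_conjugates_le_three φ α hα h4
  have hc : (conjugates α).card = 4 := by have := hcard α; lia
  refine isPreperiodic_of_card_conjugates_eq φ (d := 4) (by norm_num) ?_ α hα hc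
  intro β hβ hβc hb
  have hle := Finset.card_le_card (bigConjugates_subset φ β)
  by_cases h1 : (bigConjugates φ β).card ≤ 1
  · exact isPreperiodic_of_card_bigConjugates_le_one φ β hβ h1
  by_cases hb4 : (bigConjugates φ β).card = 4
  · exact isPreperiodic_of_bigConjugates_eq φ β hβ
      (Finset.eq_of_subset_of_card_le (bigConjugates_subset φ β) (by lia))
  have hb2 : (bigConjugates φ β).card = 2 := by lia
  obtain ⟨a, b, hab, hS⟩ := Finset.card_eq_two.1 hb2
  refine isPreperiodic_of_prod_bigConjugates φ β hβ ?_
  refine isPreperiodic_of_card_conjugates_le_three φ _ (isIntegral_prod_bigConjugates φ hβ) ?_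
  obtain ⟨σ, hσ⟩ := mem_conjugates.1 (bigConjugates_subset φ β (by simp [hS] : a ∈ _))
  obtain ⟨τ, hτ⟩ := mem_conjugates.1 (bigConjugates_subset φ β (by simp [hS] : b ∈ _))
  rw [hS, Finset.prod_pair hab]
  have hcomm : ∀ x y : Gal(F/ℚ), x * y = y * x := by
    intro x y
    have hinv : ∀ x : Gal(F/ℚ), x⁻¹ = x := fun x => inv_eq_of_mul_eq_one_left (hG2 x)
    rw [← hinv (x * y), mul_inv_rev, hinv, hinv]
  -- In exponent 2, `σ * τ` swaps `a = σ β` and `b = τ β`. So `a * b` has a nontrivial stabilizer,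
  -- hence fewer than four conjugates.
  have hρ : (σ * τ) (a * b) = a * b := by
    have h1 : (σ * τ) a = b := by
      rw [← hσ, ← hτ, ← AlgEquiv.mul_apply, mul_assoc, hcomm τ σ, ← mul_assoc, hG2, one_mul]
    have h2 : (σ * τ) b = a := by
      rw [← hσ, ← hτ, ← AlgEquiv.mul_apply, mul_assoc, hG2, mul_one]
    rw [map_mul, h1, h2, mul_comm]
  have hρ1 : σ * τ ≠ 1 := by
    intro h
    have : σ = τ := by rw [← mul_one σ, ← hG2 τ, ← mul_assoc, h, one_mul]
    exact hab (by rw [← hσ, ← hτ, this])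
  by_contra hgt
  have hcard4 : (conjugates (a * b)).card = Fintype.card Gal(F/ℚ) := by
    have := hcard (a * b)
    rw [← Nat.card_eq_fintype_card]; lia
  have hinj : Function.Injective fun ρ : Gal(F/ℚ) => ρ (a * b) := by
    have := Finset.card_image_iff.1 (hcard4.trans Finset.card_univ.symm)
    exact fun x y h => this (by simp) (by simp) h
  exact hρ1 (hinj (by simpa using hρ))

end TotallyReal

/-! ### Logarithmic vectors of units and a wandering criterion. -/

theorem isWandering_of_forall_norm_lt {P : Set ℂ} (hP : ∀ z ∈ P, M z ∈ P ∧ ‖z‖ < ‖M z‖) {z : ℂ}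
    (hz : z ∈ P) : IsWandering z := by
  have hmem : ∀ n, M^[n] z ∈ P := by
    intro n
    induction n with
    | zero => exact hz
    | succ n ih => rw [Function.iterate_succ_apply']; exact (hP _ ih).1
  have hmono : StrictMono fun n : ℕ => ‖M^[n] z‖ := by
    refine strictMono_nat_of_lt_succ fun n => ?_
    rw [Function.iterate_succ_apply']
    exact (hP _ (hmem n)).2
  exact Set.infinite_range_of_injective (Function.Injective.of_comp (f := fun w : ℂ => ‖w‖)
    hmono.injective)

/-- The map on logarithmic vectors induced by the Mahler measure. -/
noncomputable def logStep {G : Type*} [Group G] [Fintype G] (x : G → ℝ) (τ : G) : ℝ :=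
  ∑ σ with 0 < x σ, x (τ * σ)

theorem sum_logStep {G : Type*} [Group G] [Fintype G] (x : G → ℝ) (hx : ∑ σ, x σ = 0) :
    ∑ τ, logStep x τ = 0 := by
  unfold logStep
  rw [Finset.sum_comm]
  refine Finset.sum_eq_zero fun σ _ => ?_
  rw [← hx]
  exact Fintype.sum_equiv (Equiv.mulRight σ) _ _ fun τ => rfl

/-- Every real multiple of an element of the real span of an additive subgroup is at bounded
distance from the subgroup. -/
theorem exists_dist_le_of_mem_span {E : Type*} [NormedAddCommGroup E] [NormedSpace ℝ E]
    (L : Submodule ℤ E) {t : E} (ht : t ∈ Submodule.span ℝ (L : Set E)) :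
    ∃ B : ℝ, ∀ c : ℝ, ∃ l ∈ L, ‖l - c • t‖ ≤ B := by
  induction ht using Submodule.span_induction with
  | mem t ht =>
    refine ⟨‖t‖, fun c => ⟨round c • t, L.smul_mem _ ht, ?_⟩⟩
    rw [← Int.cast_smul_eq_zsmul ℝ, ← sub_smul, norm_smul, Real.norm_eq_abs, abs_sub_comm]
    have := abs_sub_round c
    nlinarith [norm_nonneg t]
  | zero => exact ⟨0, fun c => ⟨0, L.zero_mem, by simp⟩⟩
  | add s t _ _ hs ht =>
    obtain ⟨B, hB⟩ := hs
    obtain ⟨B', hB'⟩ := ht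
    refine ⟨B + B', fun c => ?_⟩
    obtain ⟨l, hl, h⟩ := hB c
    obtain ⟨l', hl', h'⟩ := hB' c
    refine ⟨l + l', L.add_mem hl hl', ?_⟩
    rw [smul_add, add_sub_add_comm]
    exact (norm_add_le _ _).trans (add_le_add h h')
  | smul a t _ ht =>
    obtain ⟨B, hB⟩ := ht
    refine ⟨B, fun c => ?_⟩
    obtain ⟨l, hl, h⟩ := hB (c * a)
    exact ⟨l, hl, by rwa [smul_smul]⟩

section LogVector

variable {F : Type*} [Field F]

/-- The property of being a unit of the ring of integers of a number field. -/
def IsAlgebraicUnit (α : F) : Prop := α ≠ 0 ∧ IsIntegral ℤ α ∧ IsIntegral ℤ α⁻¹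

theorem IsAlgebraicUnit.mul {α β : F} (hα : IsAlgebraicUnit α) (hβ : IsAlgebraicUnit β) :
    IsAlgebraicUnit (α * β) :=
  ⟨mul_ne_zero hα.1 hβ.1, hα.2.1.mul hβ.2.1, by rw [mul_inv]; exact hα.2.2.mul hβ.2.2⟩

theorem isAlgebraicUnit_one : IsAlgebraicUnit (1 : F) :=
  ⟨one_ne_zero, isIntegral_one, by rw [inv_one]; exact isIntegral_one⟩

theorem IsAlgebraicUnit.neg {α : F} (hα : IsAlgebraicUnit α) : IsAlgebraicUnit (-α) :=
  ⟨neg_ne_zero.2 hα.1, hα.2.1.neg, by rw [inv_neg]; exact hα.2.2.neg⟩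

theorem IsAlgebraicUnit.inv {α : F} (hα : IsAlgebraicUnit α) : IsAlgebraicUnit α⁻¹ :=
  ⟨inv_ne_zero hα.1, hα.2.2, by rw [inv_inv]; exact hα.2.1⟩

theorem IsAlgebraicUnit.zpow {α : F} (hα : IsAlgebraicUnit α) (n : ℤ) :
    IsAlgebraicUnit (α ^ n) := by
  have hpow : ∀ k : ℕ, IsAlgebraicUnit (α ^ k) := fun k =>
    ⟨pow_ne_zero k hα.1, hα.2.1.pow k, by rw [← inv_pow]; exact hα.2.2.pow k⟩
  rcases n with k | k
  · simpa using hpow k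
  · rw [zpow_negSucc]; exact (hpow _).inv

theorem IsAlgebraicUnit.prod {ι : Type*} {s : Finset ι} {f : ι → F}
    (h : ∀ i ∈ s, IsAlgebraicUnit (f i)) : IsAlgebraicUnit (∏ i ∈ s, f i) :=
  Finset.prod_induction f IsAlgebraicUnit (fun _ _ => IsAlgebraicUnit.mul) isAlgebraicUnit_one h

theorem IsAlgebraicUnit.map {E : Type*} [Field E] {α : F} (hα : IsAlgebraicUnit α) (f : F →+* E) :
    IsAlgebraicUnit (f α) :=
  ⟨by simpa using hα.1, hα.2.1.map f.toIntAlgHom, by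
    rw [← map_inv₀]; exact hα.2.2.map f.toIntAlgHom⟩

theorem isAlgebraicUnit_coe (u : (NumberField.RingOfIntegers F)ˣ) :
    IsAlgebraicUnit ((u : NumberField.RingOfIntegers F) : F) := by
  refine ⟨NumberField.Units.coe_ne_zero u, NumberField.RingOfIntegers.isIntegral_coe _, ?_⟩
  have : ((u : NumberField.RingOfIntegers F) : F)⁻¹ =
      ((u⁻¹ : (NumberField.RingOfIntegers F)ˣ) : NumberField.RingOfIntegers F) := by
    rw [inv_eq_iff_eq_inv, eq_comm]
    refine inv_eq_of_mul_eq_one_left ?_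
    rw [← map_mul]
    simp
  rw [this]
  exact NumberField.RingOfIntegers.isIntegral_coe _

theorem IsAlgebraicUnit.exists_coe_eq {α : F} (hα : IsAlgebraicUnit α) :
    ∃ u : (NumberField.RingOfIntegers F)ˣ, ((u : NumberField.RingOfIntegers F) : F) = α := by
  refine ⟨⟨⟨α, hα.2.1⟩, ⟨α⁻¹, hα.2.2⟩, ?_, ?_⟩, rfl⟩
  · ext; exact mul_inv_cancel₀ hα.1
  · ext; exact inv_mul_cancel₀ hα.1

variable [NumberField F] (φ : F →+* ℂ)

/-- The vector of logarithms of absolute values of conjugates. -/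
noncomputable def logVec (α : F) (σ : Gal(F/ℚ)) : ℝ := Real.log ‖φ (σ α)‖

theorem logVec_neg (α : F) : logVec φ (-α) = logVec φ α := by
  funext σ; simp [logVec]

theorem logVec_zpow (α : F) (n : ℤ) (σ : Gal(F/ℚ)) :
    logVec φ (α ^ n) σ = n * logVec φ α σ := by
  rw [logVec, map_zpow₀, map_zpow₀, norm_zpow, Real.log_zpow]; rfl

theorem logVec_prod {ι : Type*} (s : Finset ι) (f : ι → F) (hf : ∀ i ∈ s, f i ≠ 0)
    (σ : Gal(F/ℚ)) : logVec φ (∏ i ∈ s, f i) σ = ∑ i ∈ s, logVec φ (f i) σ := by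
  rw [logVec, map_prod, map_prod, norm_prod, Real.log_prod (fun i hi => by simpa using hf i hi)]
  rfl

theorem logVec_apply (α : F) (σ τ : Gal(F/ℚ)) : logVec φ (σ α) τ = logVec φ α (τ * σ) := rfl

theorem logVec_pos_iff (α : F) (σ : Gal(F/ℚ)) :
    0 < logVec φ α σ ↔ 1 < ‖φ (σ α)‖ :=
  Real.log_pos_iff (norm_nonneg _)

theorem M_apply_eq_prod_of_injective [IsGalois ℚ F] {α : F} (hα : IsIntegral ℤ α)
    (hinj : Function.Injective fun σ : Gal(F/ℚ) => σ α) :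
    M (φ α) = (∏ σ : Gal(F/ℚ), max 1 ‖φ (σ α)‖ : ℝ) := by
  classical
  rw [M_apply_eq φ α hα, conjugates, Finset.prod_image hinj.injOn]

variable [NumberField.IsTotallyReal F]

/-- In a totally real field, a nonzero element with a conjugate of absolute value `1` is `±1`. -/
theorem logVec_eq_zero_of_apply_eq_zero {α : F} (hα : α ≠ 0) {σ : Gal(F/ℚ)}
    (h : logVec φ α σ = 0) : logVec φ α = 0 := by
  have h1 : ‖φ (σ α)‖ = 1 := by
    have hpos : 0 < ‖φ (σ α)‖ := by simpa using hα
    exact Real.eq_one_of_pos_of_log_eq_zero hpos h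
  have h2 : σ α = 1 ∨ σ α = -1 := by
    rcases norm_apply_eq_or φ (σ α) with h3 | h3 <;> rw [h1] at h3
    · left; exact φ.injective (by rw [← h3]; simp)
    · right
      have : -σ α = 1 := φ.injective (by rw [← h3]; simp)
      rw [← this, neg_neg]
  have h3 : α = 1 ∨ α = -1 := by
    rcases h2 with h2 | h2
    · left; exact σ.injective (by rw [h2, map_one])
    · right; exact σ.injective (by rw [h2, map_neg, map_one])
  funext τ
  rcases h3 with rfl | rfl <;> simp [logVec]

variable [IsGalois ℚ F]

/-- Injectivity lets the group index the conjugates without repetition. The sign of `β` is free, as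
log vectors do not see it. -/
theorem exists_apply_eq_M_and_logVec_eq {α : F} (hα : IsAlgebraicUnit α)
    (hinj : Function.Injective fun σ : Gal(F/ℚ) => σ α) :
    ∃ β : F, IsAlgebraicUnit β ∧ M (φ α) = φ β ∧ logVec φ β = logStep (logVec φ α) := by
  classical
  set S : Finset Gal(F/ℚ) := Finset.univ.filter fun σ => 0 < logVec φ α σ with hS
  set β := ∏ σ ∈ S, σ α with hβ
  have hβu : IsAlgebraicUnit β := IsAlgebraicUnit.prod fun σ _ => hα.map (σ : F →+* F)
  have hM : M (φ α) = (‖φ β‖ : ℝ) := by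
    rw [M_apply_eq_prod_of_injective φ hα.2.1 hinj, hβ, map_prod, norm_prod, hS, Finset.prod_filter]
    congr 1
    refine Finset.prod_congr rfl fun σ _ => ?_
    simp only [logVec_pos_iff φ]
    split_ifs with h
    · exact max_eq_right h.le
    · exact max_eq_left (not_lt.1 h)
  have hlog : logVec φ β = logStep (logVec φ α) := by
    funext τ
    rw [hβ, logVec_prod φ S (fun σ => σ α) (fun σ _ => (hα.map (σ : F →+* F)).1)]
    rfl
  rcases norm_apply_eq_or φ β with h | h
  · exact ⟨β, hβu, hM.trans h, hlog⟩
  · exact ⟨-β, hβu.neg, hM.trans h, by rw [logVec_neg, hlog]⟩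

/-- A criterion for wandering: the logarithmic vector lies in a set that is invariant under
`logStep` and consists of vectors without translation symmetry and with two positive entries. -/
theorem isWandering_of_logVec_mem (C : Set (Gal(F/ℚ) → ℝ))
    (hstab : ∀ x ∈ C, ∀ g, (∀ τ, x (τ * g) = x τ) → g = 1)
    (hpos : ∀ x ∈ C, ∃ σ τ, σ ≠ τ ∧ 0 < x σ ∧ 0 < x τ)
    (hstep : ∀ x ∈ C, ∑ σ, x σ = 0 → (∀ σ, x σ ≠ 0) → (∀ σ, logStep x σ ≠ 0) → logStep x ∈ C)
    {α : F} (hα : IsAlgebraicUnit α) (hsum : ∑ σ, logVec φ α σ = 0) (hC : logVec φ α ∈ C) :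
    IsWandering (φ α) := by
  classical
  refine isWandering_of_forall_norm_lt (P := {z | ∃ α : F, z = φ α ∧ IsAlgebraicUnit α ∧
    ∑ σ, logVec φ α σ = 0 ∧ logVec φ α ∈ C}) ?_ ⟨α, rfl, hα, hsum, hC⟩
  rintro _ ⟨α, rfl, hα, hsum, hC⟩
  have hinj : Function.Injective fun σ : Gal(F/ℚ) => σ α := by
    intro σ τ h
    have h1 : (τ⁻¹ * σ) α = α := by
      have h : σ α = τ α := h
      rw [AlgEquiv.mul_apply, h, ← AlgEquiv.mul_apply]; simp
    have h2 := hstab _ hC (τ⁻¹ * σ) fun ρ => by rw [← logVec_apply, h1]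
    exact (inv_mul_eq_one.1 h2).symm
  obtain ⟨β, hβ, hM, hlog⟩ := exists_apply_eq_M_and_logVec_eq φ hα hinj
  obtain ⟨σ, τ, hστ, hσ, hτ⟩ := hpos _ hC
  have hnz : ∀ σ, logVec φ α σ ≠ 0 := by
    intro ρ h
    rw [logVec_eq_zero_of_apply_eq_zero φ hα.1 h] at hσ
    exact lt_irrefl _ hσ
  -- One zero entry would force all entries to vanish, but the entry of `logStep` at `1` is a
  -- nonempty sum of positive terms.
  have hnz' : ∀ ρ, logVec φ β ρ ≠ 0 := by
    intro ρ h
    have h0 : logVec φ β 1 = 0 := by rw [logVec_eq_zero_of_apply_eq_zero φ hβ.1 h]; rfl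
    rw [hlog, logStep] at h0
    refine absurd h0 (ne_of_gt ?_)
    refine Finset.sum_pos (fun ρ hρ => ?_) ⟨σ, by simpa using hσ⟩
    rw [one_mul]; exact (Finset.mem_filter.1 hρ).2
  refine ⟨⟨β, hM, hβ, by rw [hlog]; exact sum_logStep _ hsum, ?_⟩, ?_⟩
  · rw [hlog]
    exact hstep _ hC hsum hnz (by rw [← hlog]; exact hnz')
  -- A big conjugate other than `α` itself gives `‖M α‖ ≥ ‖α‖ * ‖ρ α‖ > ‖α‖`.
  · obtain ⟨ρ, hρ1, hρ⟩ : ∃ ρ, ρ ≠ 1 ∧ 0 < logVec φ α ρ := by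
      by_cases h : σ = 1
      · exact ⟨τ, fun h' => hστ (h.trans h'.symm), hτ⟩
      · exact ⟨σ, h, hσ⟩
    rw [M_apply_eq_prod_of_injective φ hα.2.1 hinj, Complex.norm_real, Real.norm_eq_abs,
      abs_of_nonneg (Finset.prod_nonneg fun _ _ => by positivity)]
    rw [logVec_pos_iff φ] at hρ
    have hαpos : 0 < ‖φ α‖ := by simpa using hα.1
    calc ‖φ α‖ < ‖φ α‖ * ‖φ (ρ α)‖ := lt_mul_of_one_lt_right hαpos hρ
      _ ≤ max 1 ‖φ ((1 : Gal(F/ℚ)) α)‖ * max 1 ‖φ (ρ α)‖ := by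
        gcongr
        · exact le_max_right _ _
        · exact le_max_right _ _
      _ = ∏ σ ∈ {1, ρ}, max 1 ‖φ (σ α)‖ := by rw [Finset.prod_pair hρ1.symm]
      _ ≤ ∏ σ : Gal(F/ℚ), max 1 ‖φ (σ α)‖ :=
        Finset.prod_le_prod_of_subset_of_one_le (Finset.subset_univ _)
          (fun _ _ => by positivity) fun _ _ _ => le_max_left _ _

/-- The infinite places of a totally real Galois number field correspond to the elements of its
Galois group. -/
theorem bijective_infinitePlace_mk :
    Function.Bijective fun σ : Gal(F/ℚ) => NumberField.InfinitePlace.mk (φ.comp (σ : F →+* F)) := by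
  constructor
  · intro σ τ h
    have hr := NumberField.ComplexEmbedding.isReal_iff.1
      (NumberField.IsTotallyReal.complexEmbedding_isReal (φ.comp (σ : F →+* F)))
    have h' : φ.comp (σ : F →+* F) = φ.comp (τ : F →+* F) := by
      rcases NumberField.InfinitePlace.mk_eq_iff.1 h with h | h
      · exact h
      · rwa [hr] at h
    ext x
    exact φ.injective (RingHom.congr_fun h' x)
  · intro w
    obtain ⟨σ, hσ⟩ := NumberField.ComplexEmbedding.exists_comp_symm_eq_of_comp_eq (k := ℚ) φ
      w.embedding (Subsingleton.elim _ _)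
    refine ⟨σ.symm, ?_⟩
    simp only
    rw [← NumberField.InfinitePlace.mk_embedding w, ← hσ]

/-- The logarithmic vectors of units are at bounded distance from every line in the trace-zero
hyperplane. -/
theorem exists_isAlgebraicUnit_logVec_close (v : Gal(F/ℚ) → ℝ) (hv : ∑ σ, v σ = 0) :
    ∃ B : ℝ, 0 ≤ B ∧ ∀ c : ℝ, ∃ α : F, IsAlgebraicUnit α ∧ ∑ σ, logVec φ α σ = 0 ∧
      ∀ σ, |logVec φ α σ - c * v σ| ≤ B := by
  classical
  let e : Gal(F/ℚ) ≃ NumberField.InfinitePlace F := Equiv.ofBijective _ (bijective_infinitePlace_mk φ)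
  have he : ∀ σ (x : F), e σ x = ‖φ (σ x)‖ := fun σ x => rfl
  let t : NumberField.Units.dirichletUnitTheorem.logSpace F := fun w => v (e.symm w.1)
  obtain ⟨B, hB⟩ := exists_dist_le_of_mem_span (NumberField.Units.unitLattice F) (t := t) (by
    rw [NumberField.Units.dirichletUnitTheorem.unitLattice_span_eq_top]; trivial)
  have hB0 : 0 ≤ B := by
    obtain ⟨l, _, h⟩ := hB 0
    exact (norm_nonneg _).trans h
  -- The log space omits the place `w₀`. By the trace-zero condition its error is minus the sum of
  -- the others, hence the factor.
  refine ⟨Fintype.card Gal(F/ℚ) * B, by positivity, fun c => ?_⟩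
  obtain ⟨l, hl, hlB⟩ := hB c
  obtain ⟨u, -, rfl⟩ := hl
  obtain ⟨u, rfl⟩ := Additive.ofMul.surjective u
  set α : F := ((u : NumberField.RingOfIntegers F) : F) with hα
  have hsum : ∑ σ, logVec φ α σ = 0 := by
    rw [← NumberField.Units.sum_mult_mul_log u]
    refine Fintype.sum_equiv e _ _ fun σ => ?_
    rw [NumberField.IsTotallyReal.mult_eq, he, Nat.cast_one, one_mul]
    rfl
  refine ⟨α, isAlgebraicUnit_coe u, hsum, ?_⟩
  set σ₀ := e.symm NumberField.Units.dirichletUnitTheorem.w₀ with hσ₀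
  have hne : ∀ σ, σ ≠ σ₀ → |logVec φ α σ - c * v σ| ≤ B := by
    intro σ hσ
    have hw : e σ ≠ NumberField.Units.dirichletUnitTheorem.w₀ := fun h => hσ (by
      rw [hσ₀, ← h, Equiv.symm_apply_apply])
    have h1 := (norm_le_pi_norm _ (⟨e σ, hw⟩ : {w // w ≠ _})).trans hlB
    have h2 : t ⟨e σ, hw⟩ = v σ := congrArg v (e.symm_apply_apply σ)
    rw [Pi.sub_apply, Pi.smul_apply, h2, Real.norm_eq_abs] at h1
    have h3 : ((NumberField.Units.logEmbedding F).toIntLinearMap (Additive.ofMul u)) ⟨e σ, hw⟩ =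
        logVec φ α σ := by
      change (NumberField.Units.logEmbedding F (Additive.ofMul u)) ⟨e σ, hw⟩ = _
      rw [NumberField.Units.dirichletUnitTheorem.logEmbedding_component,
        NumberField.IsTotallyReal.mult_eq, Nat.cast_one, one_mul, he]
      rfl
    rwa [h3, smul_eq_mul] at h1
  have hcard : (1 : ℝ) ≤ Fintype.card Gal(F/ℚ) := by exact_mod_cast Fintype.card_pos
  intro σ
  by_cases hσ : σ = σ₀
  · have hd : ∑ σ, (logVec φ α σ - c * v σ) = 0 := by
      rw [Finset.sum_sub_distrib, hsum, ← Finset.mul_sum, hv]; simp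
    rw [← Finset.add_sum_erase _ _ (Finset.mem_univ σ)] at hd
    rw [eq_neg_of_add_eq_zero_left hd, abs_neg]
    refine (Finset.abs_sum_le_sum_abs _ _).trans ?_
    refine (Finset.sum_le_card_nsmul _ _ B fun τ hτ => hne τ ?_).trans ?_
    · rw [← hσ]; exact (Finset.mem_erase.1 hτ).1
    · rw [nsmul_eq_mul]
      gcongr
      exact Finset.card_le_univ _
  · exact (hne σ hσ).trans (le_mul_of_one_le_left hB0 hcard)

end LogVector

/-! ### Unimodal periodic functions and sliding window sums. -/

open Finset

/-- An `n`-periodic function on `ℤ` is unimodal if it is first nonincreasing and then nondecreasing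
on a suitable period. -/
def IsUnimodal (n : ℤ) (x : ℤ → ℝ) : Prop :=
  ∃ p q, p ≤ q ∧ q ≤ p + n ∧ (∀ k, p ≤ k → k < q → x (k + 1) ≤ x k) ∧
    ∀ k, q ≤ k → k < p + n → x k ≤ x (k + 1)

theorem le_of_forall_succ_le {x : ℤ → ℝ} {p q : ℤ} (h : ∀ k, p ≤ k → k < q → x (k + 1) ≤ x k)
    {k l : ℤ} (hk : p ≤ k) (hkl : k ≤ l) (hl : l ≤ q) : x l ≤ x k := by
  induction l, hkl using Int.leInduction with
  | base => exact le_rfl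
  | succ l hkl ih => exact (h l (by lia) (by lia)).trans (ih (by lia))

theorem ge_of_forall_le_succ {x : ℤ → ℝ} {p q : ℤ} (h : ∀ k, p ≤ k → k < q → x k ≤ x (k + 1))
    {k l : ℤ} (hk : p ≤ k) (hkl : k ≤ l) (hl : l ≤ q) : x k ≤ x l := by
  have := le_of_forall_succ_le (x := fun k => -x k) (p := p) (q := q)
    (fun k hk hl => neg_le_neg (h k hk hl)) hk hkl hl
  exact neg_le_neg_iff.1 this

/-- A function on an interval of integers that stays nonpositive once it is negative changes sign
at most once. -/
theorem exists_sign_change {f : ℤ → ℝ} {p q : ℤ} (hpq : p ≤ q)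
    (h : ∀ k l, p ≤ k → k < l → l < q → f k < 0 → f l ≤ 0) :
    ∃ r, p ≤ r ∧ r ≤ q ∧ (∀ k, p ≤ k → k < r → 0 ≤ f k) ∧ ∀ k, r ≤ k → k < q → f k ≤ 0 := by
  by_cases hex : ∃ k, (p ≤ k ∧ k < q) ∧ f k < 0
  · obtain ⟨r, ⟨⟨hpr, hrq⟩, hr⟩, hmin⟩ := Int.exists_least_of_bdd
      (P := fun k => (p ≤ k ∧ k < q) ∧ f k < 0) ⟨p, fun k hk => hk.1.1⟩ hex
    refine ⟨r, hpr, hrq.le, fun k hk hkr => ?_, fun k hk hkq => ?_⟩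
    · by_contra hneg
      exact absurd (hmin k ⟨⟨hk, by lia⟩, not_le.1 hneg⟩) (by lia)
    · rcases hk.eq_or_lt with rfl | hlt
      · exact hr.le
      · exact h r k hpr hlt hkq hr
  · push Not at hex
    exact ⟨q, hpq, le_rfl, fun k hk hkq => hex k ⟨hk, hkq⟩, fun k hk hkq => by lia⟩

/-- Sums of a unimodal periodic function over a sliding window are unimodal. -/
theorem IsUnimodal.of_sub_eq {n L a : ℤ} {x y : ℤ → ℝ} (hx : Function.Periodic x n)
    (hu : IsUnimodal n x) (hL : 0 ≤ L) (hLn : L ≤ n)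
    (hy : ∀ k, y k - y (k + 1) = x (k + a) - x (k + a + L)) : IsUnimodal n y := by
  obtain ⟨p, q, hpq, hqp, hdec, hinc⟩ := hu
  -- The decrements of `y` are a shift of `f`, so it suffices that `f` changes sign once on the
  -- descending and once on the ascending branch of `x`.
  set f : ℤ → ℝ := fun k => x k - x (k + L) with hf
  have hfn : ∀ k, f (k + n) = f k := by
    intro k
    simp only [hf]
    rw [hx k, show k + n + L = k + L + n by ring, hx]
  have hwrap : ∀ k, x (k + L) = x (k + L - n) := fun k => (hx.sub_eq (k + L)).symm
  -- If `k + L` is still on the descent, `f k ≥ 0`. If `l + L` has wrapped onto the next descent, `f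
  -- l ≤ 0`. Otherwise `x` falls from `k` to `l` and rises from `k + L` to `l + L`, so `f l ≤ f k`.
  obtain ⟨r, hpr, hrq, hr1, hr2⟩ := exists_sign_change (f := f) hpq (by
    intro k l hk hkl hl hneg
    simp only [hf] at hneg ⊢
    by_cases h1 : k + L ≤ q
    · have := le_of_forall_succ_le hdec hk (show k ≤ k + L by lia) h1
      linarith
    by_cases h2 : p + n ≤ l + L
    · have := le_of_forall_succ_le hdec (show p ≤ l + L - n by lia) (show l + L - n ≤ l by lia)
        hl.le
      rw [hwrap]; linarith
    · have h3 := le_of_forall_succ_le hdec hk hkl.le hl.le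
      have h4 := ge_of_forall_le_succ hinc (show q ≤ k + L by lia) (show k + L ≤ l + L by lia)
        (by lia)
      linarith)
  obtain ⟨s, hqs, hsp, hs1, hs2⟩ := exists_sign_change (f := fun k => -f k) hqp (by
    intro k l hk hkl hl hneg
    simp only [hf] at hneg ⊢
    by_cases h1 : k + L ≤ p + n
    · have := ge_of_forall_le_succ hinc hk (show k ≤ k + L by lia) h1
      linarith
    by_cases h2 : q + n ≤ l + L
    · have := ge_of_forall_le_succ hinc (show q ≤ l + L - n by lia) (show l + L - n ≤ l by lia)
        hl.le
      rw [hwrap l]; linarith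
    · have h3 := ge_of_forall_le_succ hinc hk hkl.le hl.le
      have h4 := le_of_forall_succ_le hdec (show p ≤ k + L - n by lia)
        (show k + L - n ≤ l + L - n by lia) (by lia)
      rw [hwrap k] at hneg
      rw [hwrap l]
      linarith)
  have hfy : ∀ k, y k - y (k + 1) = f (k + a) := hy
  refine ⟨s - n - a, r - a, by lia, by lia, fun k hk hkr => ?_, fun k hk hks => ?_⟩
  · have : 0 ≤ f (k + a) := by
      by_cases h : p ≤ k + a
      · exact hr1 _ h (by lia)
      · rw [← hfn]
        have := hs2 (k + a + n) (by lia) (by lia)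
        linarith
    rw [← hfy] at this
    linarith
  · have : f (k + a) ≤ 0 := by
      by_cases h : k + a < q
      · exact hr2 _ (by lia) h
      · have := hs1 (k + a) (by lia) (by lia)
        linarith
    rw [← hfy] at this
    linarith

/-- The positive set of `x` is the arc `[a, a + L)` modulo `n`, the negative set its complement. -/
structure IsPositiveArc (n : ℤ) (x : ℤ → ℝ) (a L : ℤ) : Prop where
  pos : ∀ k, a ≤ k → k < a + L → 0 < x k
  neg : ∀ k, a + L ≤ k → k < a + n → x k < 0

theorem exists_mem_Ico_periodic {n : ℤ} (hn : 0 < n) {x : ℤ → ℝ} (hx : Function.Periodic x n)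
    (b k : ℤ) : ∃ m, b ≤ m ∧ m < b + n ∧ ∀ j, x (m + j) = x (k + j) := by
  refine ⟨b + (k - b) % n, ?_, ?_, fun j => ?_⟩
  · have := Int.emod_nonneg (k - b) hn.ne'; lia
  · have := Int.emod_lt_of_pos (k - b) hn; lia
  · have h := hx.int_mul ((k - b) / n) (b + (k - b) % n + j)
    rw [← h]
    congr 1
    have := Int.emod_add_mul_ediv (k - b) n
    linear_combination this

/-- The maximum is at `p` and the minimum at `q`, so each monotone branch crosses zero exactly once;
the positive arc is `[c - n, b)`. -/
theorem IsUnimodal.exists_isPositiveArc {n : ℤ} (hn : 0 < n) {x : ℤ → ℝ}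
    (hx : Function.Periodic x n) (hu : IsUnimodal n x) (hnz : ∀ k, x k ≠ 0) {i j : ℤ}
    (hi : 0 < x i) (hj : x j < 0) : ∃ a L, 0 < L ∧ L < n ∧ IsPositiveArc n x a L := by
  obtain ⟨p, q, hpq, hqp, hdec, hinc⟩ := hu
  have hwrap : x (p + n) = x p := hx p
  have hxp : 0 < x p := by
    obtain ⟨m, hm1, hm2, hm⟩ := exists_mem_Ico_periodic hn hx p i
    have hm0 := hm 0
    rw [add_zero, add_zero] at hm0
    rw [← hm0] at hi
    by_cases h : m ≤ q
    · exact hi.trans_le (le_of_forall_succ_le hdec le_rfl hm1 h)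
    · rw [← hwrap]
      exact hi.trans_le (ge_of_forall_le_succ hinc (by lia) hm2.le le_rfl)
  have hxq : x q < 0 := by
    obtain ⟨m, hm1, hm2, hm⟩ := exists_mem_Ico_periodic hn hx p j
    have hm0 := hm 0
    rw [add_zero, add_zero] at hm0
    rw [← hm0] at hj
    by_cases h : m ≤ q
    · exact (le_of_forall_succ_le hdec hm1 h le_rfl).trans_lt hj
    · exact (ge_of_forall_le_succ hinc le_rfl (by lia) hm2.le).trans_lt hj
  have hqn : q < p + n := by
    rcases hqp.eq_or_lt with h | h
    · rw [h, hwrap] at hxq; linarith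
    · exact h
  obtain ⟨b, hpb, hbq, hb1, hb2⟩ := exists_sign_change (f := x) (show p ≤ q + 1 by lia)
    fun k l hk hkl hl hneg => (le_of_forall_succ_le hdec hk hkl.le (by lia)).trans hneg.le
  obtain ⟨c, hqc, hcp, hc1, hc2⟩ := exists_sign_change (f := fun k => -x k) hqp
    fun k l hk hkl hl hneg => by
      have := ge_of_forall_le_succ hinc hk hkl.le hl.le
      linarith
  have hb' : b ≤ q := by
    by_contra h
    have := hb1 q hpq (by lia)
    linarith
  have hc' : q < c := by
    rcases hqc.eq_or_lt with h | h
    · have := hc2 q h.symm.le hqn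
      linarith
    · exact h
  have hb'' : p < b := by
    rcases hpb.eq_or_lt with h | h
    · have := hb2 p h.symm.le (by lia)
      linarith
    · exact h
  refine ⟨c - n, b - c + n, by lia, by lia, ⟨fun k hk hkb => ?_, fun k hk hkc => ?_⟩⟩
  · refine lt_of_le_of_ne ?_ (hnz k).symm
    by_cases h : p ≤ k
    · exact hb1 k h (by lia)
    · rw [← hx k]
      have := hc2 (k + n) (by lia) (by lia)
      linarith
  · refine lt_of_le_of_ne ?_ (hnz k)
    by_cases h : k ≤ q
    · exact hb2 k (by lia) (by lia)
    · have := hc1 k (by lia) (by lia)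
      linarith

theorem IsPositiveArc.two_le {n : ℤ} {x : ℤ → ℝ} (hx : Function.Periodic x n) {a L : ℤ}
    (h : IsPositiveArc n x a L) (hL : 0 < L) (hn : 3 ≤ n) {k : ℤ} (hk : 0 < x k)
    (hk' : 0 < x (k + 1)) : 2 ≤ L := by
  by_contra hlt
  obtain rfl : L = 1 := by lia
  obtain ⟨m, hm1, hm2, hm⟩ := exists_mem_Ico_periodic (by lia) hx a k
  have h0 := hm 0
  rw [add_zero, add_zero] at h0
  have h1 := hm 1
  rw [← h0] at hk
  rw [← h1] at hk'
  have hma : m = a := by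
    by_contra hne
    exact absurd (h.neg m (by lia) hm2) (not_lt.2 hk.le)
  subst hma
  exact absurd (h.neg (m + 1) le_rfl (by lia)) (not_lt.2 hk'.le)

theorem IsPositiveArc.le_sub_two {n : ℤ} {x : ℤ → ℝ} (hx : Function.Periodic x n) {a L : ℤ}
    (h : IsPositiveArc n x a L) (hL : L < n) (hn : 3 ≤ n) {k : ℤ} (hk : x k < 0)
    (hk' : x (k + 1) < 0) : L ≤ n - 2 := by
  by_contra hlt
  obtain rfl : L = n - 1 := by lia
  obtain ⟨m, hm1, hm2, hm⟩ := exists_mem_Ico_periodic (by lia) hx a k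
  have h0 := hm 0
  rw [add_zero, add_zero] at h0
  have h1 := hm 1
  rw [← h0] at hk
  rw [← h1] at hk'
  have hma : m = a + n - 1 := by
    by_contra hne
    exact absurd (h.pos m hm1 (by lia)) (not_lt.2 hk.le)
  subst hma
  rw [show a + n - 1 + 1 = a + n by ring, hx] at hk'
  exact lt_asymm hk' (h.pos a le_rfl (by lia))

/-- The arc pattern has no translation symmetry. -/
theorem IsPositiveArc.eq_zero_of_forall_add {n : ℤ} {x : ℤ → ℝ} (hx : Function.Periodic x n)
    {a L : ℤ} (h : IsPositiveArc n x a L) (hL : 0 < L) (hLn : L < n) {j : ℤ} (hj : 0 ≤ j)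
    (hjn : j < n) (hper : ∀ k, x (k + j) = x k) : j = 0 := by
  by_contra hne
  -- A nonzero shift moves the last positive index into the negative arc, or else the first negative
  -- index into the next positive arc.
  have h1 := hper (a + L - 1)
  have h2 := hper (a + L)
  have hp := h.pos (a + L - 1) (by lia) (by lia)
  have hm := h.neg (a + L) le_rfl (by lia)
  by_cases hc : a + L - 1 + j < a + n
  · have := h.neg (a + L - 1 + j) (by lia) hc
    linarith
  · have := h.pos (a + L + j - n) (by lia) (by lia)
    rw [hx.sub_eq] at this
    linarith

theorem sum_Ico_int_consecutive (f : ℤ → ℝ) {a b c : ℤ} (hab : a ≤ b) (hbc : b ≤ c) :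
    ∑ k ∈ Ico a b, f k + ∑ k ∈ Ico b c, f k = ∑ k ∈ Ico a c, f k := by
  rw [← Ico_union_Ico_eq_Ico hab hbc, sum_union (Ico_disjoint_Ico_consecutive a b c)]

theorem sum_Ico_add_one_sub (f : ℤ → ℝ) {b c : ℤ} (h : b ≤ c) :
    ∑ k ∈ Ico b c, f k - ∑ k ∈ Ico (b + 1) (c + 1), f k = f b - f c := by
  have h1 : Ico b (c + 1) = insert b (Ico (b + 1) (c + 1)) := by
    ext k; simp only [mem_insert, mem_Ico]; lia
  have h2 : Ico b (c + 1) = insert c (Ico b c) := by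
    ext k; simp only [mem_insert, mem_Ico]; lia
  have e1 : ∑ k ∈ Ico b (c + 1), f k = f b + ∑ k ∈ Ico (b + 1) (c + 1), f k := by
    rw [h1, sum_insert (by simp)]
  have e2 : ∑ k ∈ Ico b (c + 1), f k = f c + ∑ k ∈ Ico b c, f k := by
    rw [h2, sum_insert (by simp)]
  linarith

theorem sum_Ico_periodic {n : ℤ} (hn : 0 ≤ n) {f : ℤ → ℝ} (hf : Function.Periodic f n) (b c : ℤ) :
    ∑ k ∈ Ico b (b + n), f k = ∑ k ∈ Ico c (c + n), f k := by
  have key : ∀ b, ∑ k ∈ Ico b (b + n), f k = ∑ k ∈ Ico (b + 1) (b + 1 + n), f k := by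
    intro b
    have := sum_Ico_add_one_sub f (show b ≤ b + n by lia)
    rw [hf b, sub_self, show b + n + 1 = b + 1 + n by ring] at this
    linarith
  have hall : ∀ b, ∑ k ∈ Ico b (b + n), f k = ∑ k ∈ Ico 0 (0 + n), f k := by
    intro b
    induction b using Int.induction_on with
    | zero => rfl
    | succ i ih => rw [← ih, ← key]
    | pred i ih => rw [← ih, key, sub_add_cancel]
  rw [hall b, hall c]

theorem sum_Ico_shift (f : ℤ → ℝ) (b c k : ℤ) :
    ∑ s ∈ Ico b c, f (k + s) = ∑ j ∈ Ico (k + b) (k + c), f j := by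
  rw [← sum_image (g := fun s => k + s) (f := f) (by intro a _ b _ h; simpa using h),
    image_add_left_Ico]

/-- Invariance of unimodal arc patterns with at least two positive and two negative entries. -/
theorem exists_isPositiveArc_windowSum {n : ℤ} (hn : 4 ≤ n) {x y : ℤ → ℝ}
    (hx : Function.Periodic x n) (hu : IsUnimodal n x) {a L : ℤ} (hL : 2 ≤ L) (hLn : L ≤ n - 2)
    (h : IsPositiveArc n x a L) (hsum : ∑ k ∈ Ico 0 (0 + n), x k = 0)
    (hy : ∀ k, y k = ∑ s ∈ Ico a (a + L), x (k + s)) (hynz : ∀ k, y k ≠ 0)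
    (hysum : ∑ k ∈ Ico 0 (0 + n), y k = 0) :
    Function.Periodic y n ∧ IsUnimodal n y ∧
      ∃ a' L', 2 ≤ L' ∧ L' ≤ n - 2 ∧ IsPositiveArc n y a' L' := by
  have hyper : Function.Periodic y n := by
    intro k
    rw [hy, hy]
    refine sum_congr rfl fun s _ => ?_
    rw [add_right_comm, hx]
  have hywin : ∀ k, y k = ∑ j ∈ Ico (k + a) (k + (a + L)), x j := by
    intro k
    rw [hy, sum_Ico_shift]
  have hydiff : ∀ k, y k - y (k + 1) = x (k + a) - x (k + a + L) := by
    intro k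
    rw [hywin, hywin, ← add_assoc, ← sum_Ico_add_one_sub x (show k + a ≤ k + a + L by lia)]
    congr 3 <;> ring
  have hyu : IsUnimodal n y := hu.of_sub_eq hx (by lia) (by lia) hydiff
  -- the positive part and the negative part over a period
  set H := ∑ j ∈ Ico a (a + L), x j with hH
  have hy0 : y 0 = H := by rw [hy]; simp [hH]
  have hneg : ∑ j ∈ Ico (a + L) (a + n), x j = -H := by
    have h1 := sum_Ico_int_consecutive x (show a ≤ a + L by lia) (show a + L ≤ a + n by lia)
    rw [sum_Ico_periodic (by lia) hx a 0, hsum] at h1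
    linarith
  have hHpos : 0 < H := sum_pos (fun j hj => h.pos j (mem_Ico.1 hj).1 (mem_Ico.1 hj).2)
    ⟨a, mem_Ico.2 ⟨le_rfl, by lia⟩⟩
  have hHge : x a + x (a + L - 1) ≤ H := by
    rw [← sum_pair (show a ≠ a + L - 1 by lia)]
    refine sum_le_sum_of_subset_of_nonneg ?_ fun j hj _ =>
      (h.pos j (mem_Ico.1 hj).1 (mem_Ico.1 hj).2).le
    intro j hj
    rw [mem_insert, mem_singleton] at hj
    rw [mem_Ico]; lia
  have hHle : -H ≤ x (a + L) + x (a + n - 1) := by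
    rw [← hneg, ← sum_pair (show a + L ≠ a + n - 1 by lia), ← neg_le_neg_iff, ← sum_neg_distrib,
      ← sum_neg_distrib]
    refine sum_le_sum_of_subset_of_nonneg ?_ fun j hj _ => by
      have := h.neg j (mem_Ico.1 hj).1 (mem_Ico.1 hj).2
      linarith
    intro j hj
    rw [mem_insert, mem_singleton] at hj
    rw [mem_Ico]; lia
  -- If both neighbours of `y 0 = H` were negative, the two drops would total more than `2 * H`.
  -- They equal `x a + x (a + L - 1) - x (a + L) - x (a + n - 1)`, which is at most `2 * H` because
  -- each arc has two distinct endpoints.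
  have hadj : ∃ k, 0 < y k ∧ 0 < y (k + 1) := by
    by_contra hno
    push Not at hno
    have h1 := hno 0 (by rw [hy0]; exact hHpos)
    have h2 : y (-1) ≤ 0 := by
      by_contra hlt
      have := hno (-1) (not_le.1 hlt)
      rw [neg_add_cancel, hy0] at this
      linarith
    have d1 := hydiff 0
    have d2 := hydiff (-1)
    rw [neg_add_cancel] at d2
    have e1 : x (-1 + a) = x (a + n - 1) := by rw [← hx (-1 + a)]; congr 1; ring
    have e2 : x (-1 + a + L) = x (a + L - 1) := by congr 1; ring
    rw [e1, e2] at d2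
    rw [zero_add] at h1
    rw [zero_add, zero_add] at d1
    have h1' := lt_of_le_of_ne h1 (hynz 1)
    linarith
  -- A window of length at most `n` cannot collect more than the whole negative mass of a period.
  have hmin : ∀ k, -H ≤ y k := by
    intro k
    have hmp : Function.Periodic (fun j => min (x j) 0) n := fun j => by simp only [hx j]
    calc -H = ∑ j ∈ Ico (a + L) (a + n), min (x j) 0 := by
          rw [← hneg]
          exact sum_congr rfl fun j hj =>
            (min_eq_left (h.neg j (mem_Ico.1 hj).1 (mem_Ico.1 hj).2).le).symm
      _ = ∑ j ∈ Ico a (a + n), min (x j) 0 := by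
          rw [← sum_Ico_int_consecutive _ (show a ≤ a + L by lia) (show a + L ≤ a + n by lia),
            right_eq_add]
          exact sum_eq_zero fun j hj => min_eq_right (h.pos j (mem_Ico.1 hj).1 (mem_Ico.1 hj).2).le
      _ = ∑ j ∈ Ico (k + a) (k + a + n), min (x j) 0 := sum_Ico_periodic (by lia) hmp _ _
      _ ≤ ∑ j ∈ Ico (k + a) (k + (a + L)), min (x j) 0 := by
          rw [← neg_le_neg_iff, ← sum_neg_distrib, ← sum_neg_distrib]
          refine sum_le_sum_of_subset_of_nonneg (Ico_subset_Ico_right (by lia)) fun j _ _ => ?_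
          simp
      _ ≤ y k := by
          rw [hywin]
          exact sum_le_sum fun j _ => min_le_left _ _
  refine ⟨hyper, hyu, ?_⟩
  obtain ⟨k, hk, hk'⟩ := hadj
  have hexneg : ∃ j, y j < 0 := by
    by_contra hno
    push Not at hno
    have : 0 < ∑ k ∈ Ico 0 (0 + n), y k :=
      sum_pos (fun j _ => lt_of_le_of_ne (hno j) (hynz j).symm) ⟨0, mem_Ico.2 ⟨le_rfl, by lia⟩⟩
    linarith
  obtain ⟨j, hj⟩ := hexneg
  obtain ⟨a', L', hL'0, hL'n, harc⟩ := hyu.exists_isPositiveArc (by lia) hyper hynz hk hj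
  refine ⟨a', L', harc.two_le hyper hL'0 (by lia) hk hk', ?_, harc⟩
  -- A single negative value of `y` would balance `y 0 = H` together with another positive value,
  -- and so lie below `-H`.
  by_contra hlt
  obtain rfl : L' = n - 1 := by lia
  obtain ⟨m, hm1, hm2, hm⟩ := exists_mem_Ico_periodic (by lia) hyper a' 0
  have hm0 := hm 0
  rw [add_zero, add_zero, hy0] at hm0
  have hmne : m ≠ a' + (n - 1) := by
    rintro rfl
    have := harc.neg _ le_rfl (by lia)
    linarith
  have hsplit := sum_Ico_int_consecutive y (show a' ≤ a' + (n - 1) by lia)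
    (show a' + (n - 1) ≤ a' + n by lia)
  rw [sum_Ico_periodic (by lia) hyper a' 0, hysum] at hsplit
  have hlast : Ico (a' + (n - 1)) (a' + n) = {a' + (n - 1)} := by
    ext i; simp only [mem_Ico, mem_singleton]; lia
  rw [hlast, sum_singleton] at hsplit
  have hlb := hmin (a' + (n - 1))
  obtain ⟨m', hm'1, hm'2, hm'⟩ : ∃ m', a' ≤ m' ∧ m' < a' + (n - 1) ∧ m' ≠ m := by
    by_cases hma : m = a'
    · exact ⟨a' + 1, by lia, by lia, by lia⟩
    · exact ⟨a', le_rfl, by lia, fun h => hma h.symm⟩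
  have hge : y m + y m' ≤ ∑ i ∈ Ico a' (a' + (n - 1)), y i := by
    rw [← sum_pair hm'.symm]
    refine sum_le_sum_of_subset_of_nonneg ?_ fun i hi _ =>
      (harc.pos i (mem_Ico.1 hi).1 (mem_Ico.1 hi).2).le
    intro i hi
    rw [mem_insert, mem_singleton] at hi
    rw [mem_Ico]; lia
  have := harc.pos m' hm'1 hm'2
  linarith

/-! ### Transfer to cyclic groups. -/

section Cyclic

variable {G : Type*} [Group G] [Fintype G]

theorem periodic_zpow (g : G) (x : G → ℝ) :
    Function.Periodic (fun k : ℤ => x (g ^ k)) (Fintype.card G : ℤ) := by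
  intro k
  simp only
  rw [zpow_add, zpow_natCast, pow_card_eq_one, mul_one]

theorem bijOn_zpow {g : G} (hg : ∀ h : G, h ∈ Subgroup.zpowers g) :
    Set.BijOn (fun k : ℤ => g ^ k) (Ico (0 : ℤ) (0 + Fintype.card G) : Finset ℤ)
      (Finset.univ : Finset G) := by
  have hord : orderOf g = Fintype.card G := by
    rw [orderOf_eq_card_of_forall_mem_zpowers hg, Nat.card_eq_fintype_card]
  refine ⟨fun _ _ => by simp, ?_, ?_⟩
  · intro k hk l hl h
    simp only [zero_add, coe_Ico, Set.mem_Ico] at hk hl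
    have h1 := (zpow_eq_zpow_iff_modEq.1 h)
    rw [hord] at h1
    rwa [Int.ModEq, Int.emod_eq_of_lt hk.1 hk.2, Int.emod_eq_of_lt hl.1 hl.2] at h1
  · intro h _
    obtain ⟨k, hk⟩ := Subgroup.mem_zpowers_iff.1 (hg h)
    have hc : (0 : ℤ) < Fintype.card G := by exact_mod_cast Fintype.card_pos
    refine ⟨k % Fintype.card G, ?_, ?_⟩
    · simp only [zero_add, coe_Ico, Set.mem_Ico]
      exact ⟨Int.emod_nonneg _ hc.ne', Int.emod_lt_of_pos _ hc⟩
    · simp only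
      rw [← hord, zpow_mod_orderOf, hk]

theorem sum_eq_sum_Ico_zpow {g : G} (hg : ∀ h : G, h ∈ Subgroup.zpowers g) (f : G → ℝ) (a : ℤ) :
    ∑ h, f h = ∑ k ∈ Ico a (a + Fintype.card G), f (g ^ k) := by
  rw [sum_Ico_periodic (by positivity) (periodic_zpow g f) a 0]
  have h := bijOn_zpow hg
  exact (sum_nbij (fun k : ℤ => g ^ k) h.mapsTo h.injOn h.surjOn fun _ _ => rfl).symm

/-- The vectors on a cyclic group that are unimodal and have at least two positive and at least two
negative entries, both forming arcs. -/
def arcCone (g : G) : Set (G → ℝ) :=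
  {x | IsUnimodal (Fintype.card G) (fun k => x (g ^ k)) ∧
    ∃ a L, 2 ≤ L ∧ L ≤ (Fintype.card G : ℤ) - 2 ∧
      IsPositiveArc (Fintype.card G) (fun k => x (g ^ k)) a L}

theorem logStep_zpow {g : G} (hg : ∀ h : G, h ∈ Subgroup.zpowers g) {x : G → ℝ} {a L : ℤ}
    (hL : 0 ≤ L) (hLn : L ≤ Fintype.card G)
    (h : IsPositiveArc (Fintype.card G) (fun k => x (g ^ k)) a L) (k : ℤ) :
    logStep x (g ^ k) = ∑ s ∈ Ico a (a + L), x (g ^ (k + s)) := by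
  rw [logStep, sum_filter, sum_eq_sum_Ico_zpow hg _ a,
    ← sum_Ico_int_consecutive _ (show a ≤ a + L by lia)
      (show a + L ≤ a + Fintype.card G by lia)]
  rw [sum_eq_zero (s := Ico (a + L) _), add_zero]
  · refine sum_congr rfl fun s hs => ?_
    rw [if_pos (h.pos s (mem_Ico.1 hs).1 (mem_Ico.1 hs).2), zpow_add]
  · intro s hs
    rw [if_neg (not_lt.2 (h.neg s (mem_Ico.1 hs).1 (mem_Ico.1 hs).2).le)]

theorem logStep_mem_arcCone {g : G} (hg : ∀ h : G, h ∈ Subgroup.zpowers g)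
    (hn : 4 ≤ Fintype.card G) {x : G → ℝ} (hx : x ∈ arcCone g) (hsum : ∑ h, x h = 0)
    (hnz : ∀ h, logStep x h ≠ 0) : logStep x ∈ arcCone g := by
  obtain ⟨hu, a, L, hL, hLn, harc⟩ := hx
  obtain ⟨-, hyu, hy⟩ := exists_isPositiveArc_windowSum (y := fun k => logStep x (g ^ k))
    (by exact_mod_cast hn) (periodic_zpow g x) hu hL hLn harc
    (by rw [← sum_eq_sum_Ico_zpow hg, hsum]) (logStep_zpow hg (by lia) (by lia) harc)
    (fun k => hnz _) (by rw [← sum_eq_sum_Ico_zpow hg, sum_logStep x hsum])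
  exact ⟨hyu, hy⟩

end Cyclic

/-! ### Wandering units from arcs and from eigenvectors. -/

section Units

variable {F : Type*} [Field F] [NumberField F] [NumberField.IsTotallyReal F] [IsGalois ℚ F]
  (φ : F →+* ℂ)

/-- A totally real number field with cyclic Galois group of order at least `4` contains a wandering
unit. -/
theorem exists_isWandering_of_cyclic {g : Gal(F/ℚ)} (hg : ∀ h, h ∈ Subgroup.zpowers g)
    (hn : 4 ≤ Fintype.card Gal(F/ℚ)) : ∃ α : F, IsAlgebraicUnit α ∧ IsWandering (φ α) := by
  set n := Fintype.card Gal(F/ℚ) with hndef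
  have hbij := bijOn_zpow hg
  have hidx : ∀ h : Gal(F/ℚ), ∃ k : ℤ, (0 ≤ k ∧ k < n) ∧ g ^ k = h := by
    intro h
    obtain ⟨k, hk, hkh⟩ := hbij.surjOn (Finset.mem_coe.2 (mem_univ h))
    rw [zero_add, coe_Ico, Set.mem_Ico] at hk
    exact ⟨k, hk, hkh⟩
  choose idx hidx1 hidx2 using hidx
  have hidx3 : ∀ k : ℤ, 0 ≤ k → k < n → idx (g ^ k) = k := by
    intro k hk hkn
    refine hbij.injOn ?_ ?_ (hidx2 _)
    · rw [zero_add, coe_Ico, Set.mem_Ico]; exact hidx1 _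
    · rw [zero_add, coe_Ico, Set.mem_Ico]; exact ⟨hk, hkn⟩
  -- The target direction decreases linearly along the powers of `g`; the reflection `k ↦ n - 1 - k`
  -- negates it.
  have hvsum : ∑ h : Gal(F/ℚ), (((n : ℝ) - 1) / 2 - idx h) = 0 := by
    have hinv : ∀ h : Gal(F/ℚ), ((n : ℝ) - 1) / 2 - idx (g ^ ((n : ℤ) - 1 - idx h)) =
        -(((n : ℝ) - 1) / 2 - idx h) := by
      intro h
      have := hidx1 h
      rw [hidx3 _ (by lia) (by lia)]
      push_cast
      ring
    have hre : ∑ h : Gal(F/ℚ), (((n : ℝ) - 1) / 2 - idx h) =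
        ∑ h : Gal(F/ℚ), (((n : ℝ) - 1) / 2 - idx (g ^ ((n : ℤ) - 1 - idx h))) := by
      refine (Function.Bijective.sum_comp (e := fun h : Gal(F/ℚ) => g ^ ((n : ℤ) - 1 - idx h)) ?_
        (fun h => ((n : ℝ) - 1) / 2 - (idx h : ℝ))).symm
      refine Function.Involutive.bijective fun h => ?_
      have := hidx1 h
      rw [hidx3 _ (by lia) (by lia), sub_sub_cancel, hidx2]
    simp only [hinv, sum_neg_distrib] at hre
    linarith
  obtain ⟨B, hB0, hB⟩ := exists_isAlgebraicUnit_logVec_close φ _ hvsum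
  -- Consecutive target entries differ by 1, and those at `1` and `n - 2` have absolute value at
  -- least `1/2` as `n ≥ 4`. Scaling by `2 * B + 1` makes the order and these signs survive errors
  -- `B`.
  obtain ⟨α, hα, hsum, hclose⟩ := hB (2 * B + 1)
  set X : ℤ → ℝ := fun k => logVec φ α (g ^ k) with hX
  have hXp : Function.Periodic X n := periodic_zpow g _
  have hXc : ∀ k : ℤ, 0 ≤ k → k < n →
      |X k - (2 * B + 1) * (((n : ℝ) - 1) / 2 - k)| ≤ B := by
    intro k hk hkn
    have := hclose (g ^ k)
    rwa [hidx3 k hk hkn] at this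
  have hn4 : (4 : ℝ) ≤ n := by exact_mod_cast hn
  have hdec : ∀ k : ℤ, 0 ≤ k → k < n - 1 → X (k + 1) < X k := by
    intro k hk hkn
    have h1 := (abs_le.1 (hXc k hk (by lia))).1
    have h2 := (abs_le.1 (hXc (k + 1) (by lia) (by lia))).2
    push_cast at h2
    nlinarith
  have hX1 : 0 < X 1 := by
    have h1 := (abs_le.1 (hXc 1 (by lia) (by lia))).1
    push_cast at h1
    nlinarith
  have hX2 : X (n - 2) < 0 := by
    have h1 := (abs_le.1 (hXc (n - 2) (by lia) (by lia))).2
    push_cast at h1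
    nlinarith
  have hX0 : 0 < X 0 := hX1.trans (by simpa using hdec 0 le_rfl (by lia))
  have hX3 : X (n - 2 + 1) < 0 := (hdec (n - 2) (by lia) (by lia)).trans hX2
  have hu : IsUnimodal n X := by
    refine ⟨0, n - 1, by lia, by lia, fun k hk hkn => (hdec k hk hkn).le, fun k hk hkn => ?_⟩
    obtain rfl : k = n - 1 := by lia
    have e1 : X (n - 1 + 1) = X 0 := by rw [sub_add_cancel, ← hXp 0, zero_add]
    have e2 : X (n - 2 + 1) = X (n - 1) := by congr 1; ring
    rw [e1, ← e2]
    linarith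
  have hnz : ∀ k, X k ≠ 0 := by
    intro k hk
    have := logVec_eq_zero_of_apply_eq_zero φ hα.1 hk
    simp only [hX, this] at hX0
    exact lt_irrefl _ hX0
  obtain ⟨a, L, hL0, hLn, harc⟩ := hu.exists_isPositiveArc (by lia) hXp hnz hX0 hX2
  have hmem : logVec φ α ∈ arcCone g :=
    ⟨hu, a, L, harc.two_le hXp hL0 (by lia) hX0 (by simpa using hX1),
      harc.le_sub_two hXp hLn (by lia) hX2 hX3, harc⟩
  refine ⟨α, hα, isWandering_of_logVec_mem φ (arcCone g) ?_ ?_ ?_ hα hsum hmem⟩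
  · rintro x ⟨-, a, L, hL, hLn, harc⟩ h hstab
    rw [← hidx2 h] at hstab ⊢
    have := hidx1 h
    rw [harc.eq_zero_of_forall_add (periodic_zpow g x) (by lia) (by lia) this.1 this.2
      fun k => by rw [zpow_add]; exact hstab _, zpow_zero]
  · rintro x ⟨-, a, L, hL, hLn, harc⟩
    refine ⟨g ^ a, g ^ (a + 1), ?_, harc.pos a le_rfl (by lia), harc.pos (a + 1) (by lia) (by lia)⟩
    intro h
    have hg1 : g ^ (1 : ℤ) = g ^ (0 : ℤ) := by
      rw [zpow_add] at h
      simpa using h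
    have := hidx3 1 (by lia) (by lia)
    rw [hg1, hidx3 0 le_rfl (by lia)] at this
    lia
  · intro x hx hs _ hnz
    exact logStep_mem_arcCone hg hn hx hs hnz

/-- A totally real number field contains a wandering unit if there is an integral vector `v` on its
Galois group that is an eigenvector of `logStep` for the eigenvalue `2` and an idempotent up to
scaling for convolution. -/
theorem exists_isWandering_of_eigenvector (v : Gal(F/ℚ) → ℤ) (hv : ∀ σ, v σ ≠ 0)
    (hsum : ∑ σ, v σ = 0) (hstab : ∀ g, (∀ τ, 0 < v (τ * g) ↔ 0 < v τ) → g = 1)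
    (hpos : ∃ σ τ, σ ≠ τ ∧ 0 < v σ ∧ 0 < v τ)
    (hstep : ∀ τ, ∑ σ with 0 < v σ, v (σ⁻¹ * τ) = 2 * v τ)
    {m : ℤ} (hm : 0 < m) (hconv : ∀ τ, ∑ σ, v σ * v (τ * σ) = m * v τ) :
    ∃ α : F, IsAlgebraicUnit α ∧ IsWandering (φ α) := by
  classical
  obtain ⟨B, hB0, hB⟩ := exists_isAlgebraicUnit_logVec_close φ (fun σ => (v σ : ℝ))
    (by exact_mod_cast hsum)
  set W : ℝ := ∑ σ, |(v σ : ℝ)| with hW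
  obtain ⟨β, hβ, hβsum, hclose⟩ := hB (W * B + 1)
  set y := logVec φ β with hy
  -- An approximate eigenvector is not enough. Convolving the log vector with `v` makes the
  -- eigenvalue relation exact; by `hconv` the main term stays a positive multiple of `v`, and the
  -- error `W * B` is too small to change signs.
  set α := ∏ σ : Gal(F/ℚ), (σ β) ^ v σ with hα
  have hαu : IsAlgebraicUnit α :=
    IsAlgebraicUnit.prod fun σ _ => (hβ.map (σ : F →+* F)).zpow _
  have hx : ∀ τ, logVec φ α τ = ∑ σ, v σ * y (τ * σ) := by
    intro τ
    rw [hα, logVec_prod φ univ (fun σ => (σ β) ^ v σ)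
      (fun σ _ => ((hβ.map (σ : F →+* F)).zpow _).1)]
    exact sum_congr rfl fun σ _ => by rw [logVec_zpow]; rfl
  have hW0 : 0 ≤ W := sum_nonneg fun _ _ => abs_nonneg _
  have hxc : ∀ τ, |logVec φ α τ - (W * B + 1) * (m * v τ)| ≤ W * B := by
    intro τ
    have h1 : logVec φ α τ - (W * B + 1) * (m * v τ) =
        ∑ σ, v σ * (y (τ * σ) - (W * B + 1) * v (τ * σ)) := by
      have h2 : ((m * v τ : ℤ) : ℝ) = ∑ σ, (v σ : ℝ) * v (τ * σ) := by
        rw [← hconv τ]; push_cast; rfl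
      push_cast at h2
      rw [hx, h2, mul_sum, ← sum_sub_distrib]
      exact sum_congr rfl fun σ _ => by ring
    have h3 : W * B = ∑ σ, |(v σ : ℝ)| * B := by rw [hW, sum_mul]
    rw [h1]
    refine LE.le.trans ?_ h3.ge
    refine (abs_sum_le_sum_abs _ _).trans (sum_le_sum fun σ _ => ?_)
    rw [abs_mul]
    exact mul_le_mul_of_nonneg_left (hclose _) (abs_nonneg _)
  have hWB : 0 ≤ W * B := mul_nonneg hW0 hB0
  have hsign : ∀ τ, 0 < logVec φ α τ ↔ 0 < v τ := by
    intro τ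
    have h1 := abs_le.1 (hxc τ)
    rcases lt_or_gt_of_ne (hv τ) with h | h
    · refine iff_of_false (not_lt.2 ?_) (not_lt.2 h.le)
      have : (m * v τ : ℝ) ≤ -1 := by
        have : m * v τ ≤ -1 := by nlinarith
        exact_mod_cast this
      nlinarith
    · refine iff_of_true ?_ h
      have : (1 : ℝ) ≤ m * v τ := by
        have : 1 ≤ m * v τ := by nlinarith
        exact_mod_cast this
      nlinarith
  have hdouble : ∀ τ, ∑ σ with 0 < v σ, logVec φ α (τ * σ) = 2 * logVec φ α τ := by
    intro τ
    simp only [hx]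
    have hre : ∀ σ : Gal(F/ℚ), ∑ ρ, (v ρ : ℝ) * y (τ * σ * ρ) =
        ∑ ρ, (v (σ⁻¹ * ρ) : ℝ) * y (τ * ρ) := fun σ =>
      Fintype.sum_equiv (Equiv.mulLeft σ) _ _ fun ρ => by simp [mul_assoc]
    simp only [hre]
    rw [sum_comm, mul_sum]
    refine sum_congr rfl fun ρ _ => ?_
    have h2 : ((∑ σ with 0 < v σ, v (σ⁻¹ * ρ) : ℤ) : ℝ) = ((2 * v ρ : ℤ) : ℝ) := by rw [hstep]
    push_cast at h2
    rw [← sum_mul, h2]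
    ring
  refine ⟨α, hαu, isWandering_of_logVec_mem φ
    {x | (∀ τ, 0 < x τ ↔ 0 < v τ) ∧ ∀ τ, ∑ σ with 0 < v σ, x (τ * σ) = 2 * x τ}
    ?_ ?_ ?_ hαu ?_ ⟨hsign, hdouble⟩⟩
  · rintro x ⟨hx1, -⟩ g hg
    exact hstab g fun τ => by rw [← hx1, ← hx1, hg]
  · rintro x ⟨hx1, -⟩
    obtain ⟨σ, τ, hne, hσ, hτ⟩ := hpos
    exact ⟨σ, τ, hne, (hx1 σ).2 hσ, (hx1 τ).2 hτ⟩
  · rintro x ⟨hx1, hx2⟩ - - -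
    have h2 : logStep x = fun τ => 2 * x τ := by
      funext τ
      rw [logStep, ← hx2 τ]
      exact sum_congr (filter_congr fun σ _ => hx1 σ) fun _ _ => rfl
    rw [h2]
    refine ⟨fun τ => by rw [← hx1 τ]; simp, fun τ => ?_⟩
    rw [← mul_sum, hx2]
  · simp only [hx]
    rw [sum_comm]
    refine sum_eq_zero fun σ _ => ?_
    rw [← mul_sum, Function.Bijective.sum_comp (Group.mulRight_bijective σ) y, hβsum, mul_zero]

end Units

/-! ### Quotients of finite abelian groups. -/

section Quotients

/-- A finite abelian group that is not on the list of the main theorem has a cyclic quotient of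
order at least `4` or a quotient isomorphic to `C₂ × C₂ × C₂` or `C₃ × C₃`. -/
theorem exists_surjective_of_not_isC1OrC2OrC3OrC2xC2 (G : Type*) [CommGroup G] [Finite G]
    (h : ¬ IsC1OrC2OrC3OrC2xC2 G) :
    (∃ n, 4 ≤ n ∧ ∃ f : G →* Cyc n, Function.Surjective f) ∨
    (∃ f : G →* Cyc 2 × Cyc 2 × Cyc 2, Function.Surjective f) ∨
    ∃ f : G →* Cyc 3 × Cyc 3, Function.Surjective f := by
  classical
  obtain ⟨ι, _, n, hn, ⟨e⟩⟩ := CommGroup.equiv_prod_multiplicative_zmod_of_finite G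
  by_cases h4 : ∃ i, 4 ≤ n i
  · obtain ⟨i, hi⟩ := h4
    refine .inl ⟨n i, hi, (Pi.evalMonoidHom _ i).comp e.toMonoidHom, ?_⟩
    exact (Function.surjective_eval i).comp e.surjective
  by_cases hco : ∃ i j, (n i).Coprime (n j)
  · obtain ⟨i, j, hij⟩ := hco
    have hne : i ≠ j := by
      rintro rfl
      rw [Nat.coprime_self] at hij
      exact absurd (hn i) (by lia)
    refine .inl ⟨n i * n j, by nlinarith [hn i, hn j], ?_⟩
    let c : Cyc (n i) × Cyc (n j) ≃* Cyc (n i * n j) :=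
      (MulEquiv.prodMultiplicative _ _).symm.trans
        (ZMod.chineseRemainder hij).symm.toAddEquiv.toMultiplicative
    refine ⟨c.toMonoidHom.comp
      (((Pi.evalMonoidHom _ i).prod (Pi.evalMonoidHom _ j)).comp e.toMonoidHom), ?_⟩
    intro z
    obtain ⟨⟨a, b⟩, rfl⟩ := c.surjective z
    refine ⟨e.symm (Function.update (Function.update 1 i a) j b), ?_⟩
    simp [hne]
  push Not at h4 hco
  have h23 : ∀ i, n i = 2 ∨ n i = 3 := fun i => by have := hn i; have := h4 i; lia
  -- All orders are now 2 or 3, and no two are coprime, so they all agree.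
  obtain hall | hall : n = (fun _ => 2) ∨ n = (fun _ => 3) := by
    by_cases h2 : ∃ i, n i = 2
    · obtain ⟨i, hi⟩ := h2
      left
      funext j
      rcases h23 j with hj | hj
      · exact hj
      · exact absurd (by rw [hi, hj]; norm_num) (hco i j)
    · right
      funext j
      exact (h23 j).resolve_left fun hj => h2 ⟨j, hj⟩
  · subst hall
    let k := Fintype.equivFin ι
    let e' : G ≃* (Fin (Fintype.card ι) → Cyc 2) := e.trans (MulEquiv.arrowCongr k (MulEquiv.refl _))
    rcases hk : Fintype.card ι with _ | _ | _ | m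
    · rw [hk] at e'
      exact absurd (.inl ⟨e'.trans MulEquiv.ofUnique⟩) h
    · rw [hk] at e'
      exact absurd (.inr (.inl ⟨e'.trans (MulEquiv.funUnique (Fin 1) _)⟩)) h
    · rw [hk] at e'
      exact absurd (.inr (.inr (.inr ⟨e'.trans
        { finTwoArrowEquiv (Cyc 2) with map_mul' := fun _ _ => rfl }⟩))) h
    · rw [hk] at e'
      refine .inr (.inl ⟨((Pi.evalMonoidHom _ 0).prod
        ((Pi.evalMonoidHom _ 1).prod (Pi.evalMonoidHom _ 2))).comp e'.toMonoidHom, ?_⟩)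
      rintro ⟨a, b, c⟩
      refine ⟨e'.symm fun i => if i = 0 then a else if i = 1 then b else c, ?_⟩
      have h20 : (2 : Fin (m + 3)) ≠ 0 := by
        rw [Ne, Fin.ext_iff, Fin.val_two]; simp
      have h21 : (2 : Fin (m + 3)) ≠ 1 := by
        rw [Ne, Fin.ext_iff, Fin.val_two]; simp
      simp [h20, h21]
  · subst hall
    let k := Fintype.equivFin ι
    let e' : G ≃* (Fin (Fintype.card ι) → Cyc 3) := e.trans (MulEquiv.arrowCongr k (MulEquiv.refl _))
    rcases hk : Fintype.card ι with _ | _ | m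
    · rw [hk] at e'
      exact absurd (.inl ⟨e'.trans MulEquiv.ofUnique⟩) h
    · rw [hk] at e'
      exact absurd (.inr (.inr (.inl ⟨e'.trans (MulEquiv.funUnique (Fin 1) _)⟩))) h
    · rw [hk] at e'
      refine .inr (.inr ⟨((Pi.evalMonoidHom _ 0).prod (Pi.evalMonoidHom _ 1)).comp e'.toMonoidHom,
        ?_⟩)
      rintro ⟨a, b⟩
      refine ⟨e'.symm fun i => if i = 0 then a else b, ?_⟩
      simp

theorem card_le_three_or_of_isC1OrC2OrC3OrC2xC2 {G : Type*} [Group G]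
    (h : IsC1OrC2OrC3OrC2xC2 G) :
    Nat.card G ≤ 3 ∨ (Nat.card G = 4 ∧ ∀ g : G, g * g = 1) := by
  rcases h with ⟨⟨e⟩⟩ | ⟨⟨e⟩⟩ | ⟨⟨e⟩⟩ | ⟨⟨e⟩⟩
  · left; rw [Nat.card_congr e.toEquiv]; simp
  · left; rw [Nat.card_congr e.toEquiv]; simp
  · left; rw [Nat.card_congr e.toEquiv]; simp
  · right
    refine ⟨by rw [Nat.card_congr e.toEquiv]; simp, fun g => e.injective ?_⟩
    rw [map_mul, map_one]
    have : ∀ x : Cyc 2 × Cyc 2, x * x = 1 := by decide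
    exact this _

end Quotients

/-! ### Descent to subfields and the exceptional quotients. -/

/-- Descent to a subfield whose Galois group is a given quotient. -/
theorem exists_isWandering_of_surjective {F : Type*} [Field F] [NumberField F] [IsGalois ℚ F]
    (φ : F →+* ℂ) {Q : Type*} [Group Q] (f : Gal(F/ℚ) →* Q)
    (hf : Function.Surjective f)
    (H : ∀ (E : IntermediateField ℚ F) [IsGalois ℚ E], (Gal(E/ℚ) ≃* Q) →
      ∃ α : E, IsAlgebraicUnit α ∧ IsWandering ((φ.comp (algebraMap E F)) α)) :
    ∃ α : F, IsAlgebraicUnit α ∧ IsWandering (φ α) := by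
  have e : Gal(IntermediateField.fixedField f.ker/ℚ) ≃* Q :=
    (IsGalois.normalAutEquivQuotient f.ker).symm.trans
      (QuotientGroup.quotientKerEquivOfSurjective f hf)
  -- A `ℚ`-algebra structure is unique, which reconciles the intermediate-field structure with the
  -- canonical one used in `H`.
  have key : ∀ (E : IntermediateField ℚ F) [A : Algebra ℚ E] [IsGalois ℚ E], (Gal(E/ℚ) ≃* Q) →
      ∃ α : E, IsAlgebraicUnit α ∧ IsWandering ((φ.comp (algebraMap E F)) α) := by
    intro E A
    obtain rfl := Subsingleton.elim A DivisionRing.toRatAlgebra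
    exact H E
  have hgal := IsGalois.of_fixedField_normal_subgroup f.ker
  obtain ⟨α, hα, hw⟩ := @key (IntermediateField.fixedField f.ker) _ hgal e
  exact ⟨algebraMap _ F α, hα.map _, hw⟩

section Units

variable {F : Type*} [Field F] [NumberField F] [NumberField.IsTotallyReal F] [IsGalois ℚ F]
  (φ : F →+* ℂ)

theorem exists_isWandering_of_eigenvector_of_mulEquiv {Q : Type*} [Group Q] [Fintype Q]
    (e : Gal(F/ℚ) ≃* Q) (v : Q → ℤ) (hv : ∀ σ, v σ ≠ 0)
    (hsum : ∑ σ, v σ = 0) (hstab : ∀ g, (∀ τ, 0 < v (τ * g) ↔ 0 < v τ) → g = 1)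
    (hpos : ∃ σ τ, σ ≠ τ ∧ 0 < v σ ∧ 0 < v τ)
    (hstep : ∀ τ, ∑ σ with 0 < v σ, v (σ⁻¹ * τ) = 2 * v τ)
    {m : ℤ} (hm : 0 < m) (hconv : ∀ τ, ∑ σ, v σ * v (τ * σ) = m * v τ) :
    ∃ α : F, IsAlgebraicUnit α ∧ IsWandering (φ α) := by
  refine exists_isWandering_of_eigenvector φ (fun σ => v (e σ)) (fun σ => hv _) ?_ ?_ ?_ ?_ hm ?_
  · rw [← hsum]
    exact Fintype.sum_equiv e.toEquiv _ _ fun _ => rfl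
  · intro g hg
    refine e.injective ?_
    rw [map_one]
    refine hstab _ fun τ => ?_
    have := hg (e.symm τ)
    simpa using this
  · obtain ⟨σ, τ, h, hσ, hτ⟩ := hpos
    exact ⟨e.symm σ, e.symm τ, by simpa using h, by simpa using hσ, by simpa using hτ⟩
  · intro τ
    rw [← hstep, sum_filter, sum_filter]
    exact Fintype.sum_equiv e.toEquiv _ _ fun σ => by simp
  · intro τ
    rw [← hconv]
    exact Fintype.sum_equiv e.toEquiv _ _ fun σ => by simp

/-- The vector is the sum of the three coordinate characters, positive where at least two of them
are `1`. Each character sums to 2 over that set, and orthogonality gives `m = 8`, the group order.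
-/
theorem exists_isWandering_of_mulEquiv_C2xC2xC2 (e : Gal(F/ℚ) ≃* Cyc 2 × Cyc 2 × Cyc 2) :
    ∃ α : F, IsAlgebraicUnit α ∧ IsWandering (φ α) := by
  let χ : Cyc 2 → ℤ := fun a => if a = 1 then 1 else -1
  refine exists_isWandering_of_eigenvector_of_mulEquiv φ e (fun a => χ a.1 + χ a.2.1 + χ a.2.2)
    ?_ ?_ ?_ ?_ ?_ (m := 8) (by norm_num) ?_
  all_goals decide

/-- Here `f` is the sum of the two nontrivial characters of `C₃`. The vector is positive on the
union of the two coordinate axes, over which each of the four characters involved sums to `3 - 1 =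
2`; `m = 9` is the group order. -/
theorem exists_isWandering_of_mulEquiv_C3xC3 (e : Gal(F/ℚ) ≃* Cyc 3 × Cyc 3) :
    ∃ α : F, IsAlgebraicUnit α ∧ IsWandering (φ α) := by
  let f : Cyc 3 → ℤ := fun a => if a = 1 then 2 else -1
  refine exists_isWandering_of_eigenvector_of_mulEquiv φ e (fun a => f a.1 + f a.2)
    ?_ ?_ ?_ ?_ ?_ (m := 9) (by norm_num) ?_
  all_goals decide

theorem exists_isWandering_of_mulEquiv_cyc {n : ℕ} (hn : 4 ≤ n) (e : Gal(F/ℚ) ≃* Cyc n) :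
    ∃ α : F, IsAlgebraicUnit α ∧ IsWandering (φ α) := by
  have : IsCyclic Gal(F/ℚ) := isCyclic_of_surjective e.symm e.symm.surjective
  obtain ⟨g, hg⟩ := IsCyclic.exists_generator (α := Gal(F/ℚ))
  refine exists_isWandering_of_cyclic φ hg ?_
  rw [← Nat.card_eq_fintype_card, Nat.card_congr e.toEquiv]
  rwa [Nat.card_congr Multiplicative.toAdd, Nat.card_zmod]

/-- A totally real abelian field whose Galois group is not `C₁`, `C₂`, `C₃` or `C₂ × C₂` contains a
wandering unit. -/
theorem exists_isWandering [IsMulCommutative Gal(F/ℚ)] (h : ¬ IsC1OrC2OrC3OrC2xC2 Gal(F/ℚ)) :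
    ∃ α : F, IsAlgebraicUnit α ∧ IsWandering (φ α) := by
  let _ : CommGroup Gal(F/ℚ) := { mul_comm := mul_comm' }
  rcases exists_surjective_of_not_isC1OrC2OrC3OrC2xC2 Gal(F/ℚ) h with
    ⟨n, hn, f, hf⟩ | ⟨f, hf⟩ | ⟨f, hf⟩
  · exact exists_isWandering_of_surjective φ f hf fun E _ e =>
      exists_isWandering_of_mulEquiv_cyc _ hn e
  · exact exists_isWandering_of_surjective φ f hf fun E _ e =>
      exists_isWandering_of_mulEquiv_C2xC2xC2 _ e
  · exact exists_isWandering_of_surjective φ f hf fun E _ e =>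
      exists_isWandering_of_mulEquiv_C3xC3 _ e

end Units

end MahlerIteration

/-! ### The main theorem. -/

theorem mainTheorem1 (K : Type*) [Field K] [NumberField K] [IsAbelianGalois ℚ K]
    (φ : K →+* ℂ) :
    ((∀ α : K, MahlerIteration.IsPreperiodic (φ α)) ↔
      MahlerIteration.IsC1OrC2OrC3OrC2xC2 Gal(NumberField.maximalRealSubfield K/ℚ)) ∧
    (¬ MahlerIteration.IsC1OrC2OrC3OrC2xC2 Gal(NumberField.maximalRealSubfield K/ℚ) →
      ∃ u : (NumberField.RingOfIntegers K)ˣ,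
        MahlerIteration.IsWandering (φ ((u : NumberField.RingOfIntegers K) : K))) := by
  have hab : IsAbelianGalois ℚ (NumberField.maximalRealSubfield K) :=
    IsAbelianGalois.tower_bot ℚ (NumberField.maximalRealSubfield K) K
  let ψ : NumberField.maximalRealSubfield K →+* ℂ := φ.comp (algebraMap _ K)
  have hwander : ¬ MahlerIteration.IsC1OrC2OrC3OrC2xC2
      Gal(NumberField.maximalRealSubfield K/ℚ) → ∃ u : (NumberField.RingOfIntegers K)ˣ,
        MahlerIteration.IsWandering (φ ((u : NumberField.RingOfIntegers K) : K)) := by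
    intro h
    obtain ⟨α, hα, hw⟩ := MahlerIteration.exists_isWandering ψ h
    obtain ⟨u, hu⟩ := (hα.map (algebraMap _ K)).exists_coe_eq
    exact ⟨u, by rw [hu]; exact hw⟩
  refine ⟨⟨fun hpre => ?_, fun hG α => ?_⟩, hwander⟩
  · by_contra h
    obtain ⟨u, hu⟩ := hwander h
    exact hu (hpre _)
  · obtain ⟨β, hβ, hint⟩ := MahlerIteration.exists_mem_maximalRealSubfield_apply_eq_M φ α
    rw [← MahlerIteration.isPreperiodic_M_iff, ← hβ]
    exact MahlerIteration.isPreperiodic_of_isIntegral ψ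
      (MahlerIteration.card_le_three_or_of_isC1OrC2OrC3OrC2xC2 hG) β hint
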